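/- Let $k\ge 2$ and $M\ge 2k+1$ be integers and let $2\le d_1\le\dots\le d_k$ be integers with $d_1+\dots+d_k=M+k$. Let $f_1,\dots,f_k$ be non-zero homogeneous polynomials of degrees $d_1,\dots,d_k$ on $\mathbb P=\mathbb P^{M+k}_{\mathbb C}$ such that $F=\{f_1=\dots=f_k=0\}\subset\mathbb P$ is an irreducible reduced complete intersection of codimension $k$ (so $F$ is a Fano variety of index one and dimension $M$). Assume that $F$ is smooth and that every point $x\in F$ is regular in the following sense: in a standard affine chart $\mathbb C^{M+k}\subset\mathbb P$ with linear coordinates $z_*$ with origin at $x$, writing $f_i=q_{i,1}+\dots+q_{i,d_i}$ with $q_{i,j}$ homogeneous of degree $j$ in $z_*$, the system of equations $q_{i,j}=0$, $1\le i\le k$, $1\le j\le d_i$, $(i,j)\ne(k,d_k)$, defines a finite set of lines through the origin. Let $n\ge 0$ be an integer and let $\Sigma\subset|-nK_F|$ be a movable linear system, that is, a non-empty linear system without fixed components. Then for every irreducible subvariety $Y\subset F$ of dimension $k$, $$\mathop{\rm mult}\nolimits_Y\Sigma\le n,$$ where $\mathop{\rm mult}_Y\Sigma$ is the multiplicity along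 $Y$ of a general divisor $D\in\Sigma$, that is, the largest $m$ such that a local equation of $D$ at the generic point of $Y$ lies in the $m$-th power of the maximal ideal of the local ring $\mathcal O_{F,Y}$. -/

import Mathlib

open scoped LinearAlgebra.Projectivization

noncomputable section

/-- The polynomial ring `ℂ[x₀, …, x_N]`. -/
abbrev HomPoly (N : ℕ) : Type := MvPolynomial (Fin (N + 1)) ℂ

/-- Complex projective space `ℙ^N`, as a set of points. -/
abbrev PSpace (N : ℕ) : Type := ℙ ℂ (Fin (N + 1) → ℂ)

/-- The common zeros in `ℙ^N` of a set of (homogeneous) polynomials. -/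
def projZeros {N : ℕ} (T : Set (HomPoly N)) : Set (PSpace N) :=
  {p | ∀ g ∈ T, MvPolynomial.eval p.rep g = 0}

/-- Zariski closed subsets of `ℙ^N`. -/
def IsAlgebraicSet {N : ℕ} (Z : Set (PSpace N)) : Prop :=
  ∃ T : Set (HomPoly N), (∀ g ∈ T, ∃ m : ℕ, g.IsHomogeneous m) ∧ Z = projZeros T

/-- Irreducible Zariski closed subsets of `ℙ^N`. -/
structure ProjVariety (N : ℕ) where
  carrier : Set (PSpace N)
  isAlgebraicSet : IsAlgebraicSet carrier
  nonempty : carrier.Nonempty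
  irreducible : ∀ Z₁ Z₂ : Set (PSpace N), IsAlgebraicSet Z₁ → IsAlgebraicSet Z₂ →
    carrier ⊆ Z₁ ∪ Z₂ → carrier ⊆ Z₁ ∨ carrier ⊆ Z₂

/-- The punctured affine cone over a subset of `ℙ^N`. -/
def affineCone {N : ℕ} (Z : Set (PSpace N)) : Set (Fin (N + 1) → ℂ) :=
  {v | ∃ hv : v ≠ 0, Projectivization.mk ℂ v hv ∈ Z}

lemma smul_mem_affineCone {N : ℕ} {Z : Set (PSpace N)} {v : Fin (N + 1) → ℂ}
    (hv : v ∈ affineCone Z) {t : ℂ} (ht : t ≠ 0) : t • v ∈ affineCone Z := by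
  obtain ⟨h0, hZ⟩ := hv
  refine ⟨smul_ne_zero ht h0, ?_⟩
  have : Projectivization.mk ℂ (t • v) (smul_ne_zero ht h0) = Projectivization.mk ℂ v h0 := by
    rw [Projectivization.mk_eq_mk_iff']
    exact ⟨t, rfl⟩
  rwa [this]

lemma eval_smul_of_isHomogeneous {N m : ℕ} {g : HomPoly N} (hg : g.IsHomogeneous m) (t : ℂ)
    (v : Fin (N + 1) → ℂ) :
    MvPolynomial.eval (t • v) g = t ^ m * MvPolynomial.eval v g := by
  rw [MvPolynomial.eval_eq, MvPolynomial.eval_eq, Finset.mul_sum]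
  refine Finset.sum_congr rfl fun d hd => ?_
  have hdeg : ∑ i ∈ d.support, d i = m := by
    by_contra h
    exact MvPolynomial.mem_support_iff.mp hd (hg.coeff_eq_zero h)
  simp only [Pi.smul_apply, smul_eq_mul, mul_pow, Finset.prod_mul_distrib,
    Finset.prod_pow_eq_pow_sum, hdeg]
  ring

lemma rep_mem_affineCone {N : ℕ} {Z : Set (PSpace N)} {p : PSpace N} (hp : p ∈ Z) :
    p.rep ∈ affineCone Z :=
  ⟨p.rep_nonzero, by rwa [Projectivization.mk_rep]⟩

lemma eval_eq_zero_of_rep {N m : ℕ} {g : HomPoly N} (hg : g.IsHomogeneous m)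
    {v : Fin (N + 1) → ℂ} (hv : v ≠ 0)
    (h : MvPolynomial.eval (Projectivization.mk ℂ v hv).rep g = 0) :
    MvPolynomial.eval v g = 0 := by
  obtain ⟨a, ha⟩ := Projectivization.exists_smul_eq_mk_rep ℂ v hv
  rw [← ha, Units.smul_def, eval_smul_of_isHomogeneous hg] at h
  exact (mul_eq_zero.mp h).resolve_left (pow_ne_zero _ a.ne_zero)

/-- The `n`-th tensor power of the dual of `⋀^M Ω_{K/ℂ}`, for a field `K` over `ℂ`: the
`K`-multilinear functionals of `n` elements of `⋀^M Ω_{K/ℂ}`. -/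
def RatSections (K : Type) [Field K] [Algebra ℂ K] (M n : ℕ) : Type :=
  MultilinearMap K (fun _ : Fin n => ⋀[K]^M (Ω[K⁄ℂ])) K

instance RatSections.instAddCommGroup (K : Type) [Field K] [Algebra ℂ K] (M n : ℕ) :
    AddCommGroup (RatSections K M n) :=
  inferInstanceAs (AddCommGroup (MultilinearMap K (fun _ : Fin n => ⋀[K]^M (Ω[K⁄ℂ])) K))

instance RatSections.instModule (K : Type) [Field K] [Algebra ℂ K] (M n : ℕ) :
    Module ℂ (RatSections K M n) :=
  inferInstanceAs (Module ℂ (MultilinearMap K (fun _ : Fin n => ⋀[K]^M (Ω[K⁄ℂ])) K))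

/-- The value of `s` on the `n` forms `da_{j,1} ∧ ⋯ ∧ da_{j,M}`. -/
def RatSections.onWedges {K : Type} [Field K] [Algebra ℂ K] {M n : ℕ} (s : RatSections K M n)
    (a : Fin n → Fin M → K) : K :=
  let t : MultilinearMap K (fun _ : Fin n => ⋀[K]^M (Ω[K⁄ℂ])) K := s
  t fun j => exteriorPower.ιMulti K M fun i => KaehlerDifferential.D ℂ K (a j i)

lemma RatSections.onWedges_add {K : Type} [Field K] [Algebra ℂ K] {M n : ℕ}
    (s t : RatSections K M n) (a : Fin n → Fin M → K) :
    (s + t).onWedges a = s.onWedges a + t.onWedges a := rfl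

lemma RatSections.onWedges_zero {K : Type} [Field K] [Algebra ℂ K] {M n : ℕ}
    (a : Fin n → Fin M → K) : (0 : RatSections K M n).onWedges a = 0 := rfl

lemma RatSections.onWedges_smul {K : Type} [Field K] [Algebra ℂ K] {M n : ℕ} (c : ℂ)
    (s : RatSections K M n) (a : Fin n → Fin M → K) :
    (c • s).onWedges a = c • s.onWedges a := rfl

namespace ProjVariety

variable {N : ℕ}

/-- The homogeneous ideal of all polynomials vanishing on the variety. -/
def ideal (X : ProjVariety N) : Ideal (HomPoly N) :=
  MvPolynomial.vanishingIdeal ℂ (affineCone X.carrier)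

lemma mem_ideal {X : ProjVariety N} {g : HomPoly N} :
    g ∈ X.ideal ↔ ∀ v ∈ affineCone X.carrier, MvPolynomial.eval v g = 0 := by
  simp [ideal, MvPolynomial.aeval_eq_eval]

lemma homogeneousComponent_mem (X : ProjVariety N) {g : HomPoly N} (hg : g ∈ X.ideal) (m : ℕ) :
    MvPolynomial.homogeneousComponent m g ∈ X.ideal := by
  rw [mem_ideal] at hg ⊢
  intro v hv
  let q : Polynomial ℂ := ∑ i ∈ Finset.range (g.totalDegree + 1),
    Polynomial.C (MvPolynomial.eval v (MvPolynomial.homogeneousComponent i g)) * Polynomial.X ^ i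
  have hq : ∀ t : ℂ, t ≠ 0 → q.eval t = 0 := by
    intro t ht
    have h1 := hg _ (smul_mem_affineCone hv ht)
    rw [← MvPolynomial.sum_homogeneousComponent g, map_sum] at h1
    rw [← h1, Polynomial.eval_finsetSum]
    refine Finset.sum_congr rfl fun i _ => ?_
    rw [eval_smul_of_isHomogeneous (MvPolynomial.homogeneousComponent_isHomogeneous i g)]
    rw [Polynomial.eval_mul, Polynomial.eval_C, Polynomial.eval_pow, Polynomial.eval_X, mul_comm]
  have hq0 : q = 0 := by
    refine Polynomial.eq_zero_of_infinite_isRoot q ?_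
    refine Set.Infinite.mono (s := {0}ᶜ) (fun t ht => hq t ht) ?_
    exact (Set.finite_singleton (0 : ℂ)).infinite_compl
  by_cases hm : m < g.totalDegree + 1
  · have := congrArg (fun r => Polynomial.coeff r m) hq0
    simpa [q, Polynomial.finsetSum_coeff, Polynomial.coeff_C_mul, Polynomial.coeff_X_pow, hm,
      Nat.lt_succ_iff.mp hm] using this
  · rw [MvPolynomial.homogeneousComponent_eq_zero m g (by omega), map_zero]

lemma mem_or_mem_of_isHomogeneous (X : ProjVariety N) {a b : HomPoly N} {m n : ℕ}
    (ha : a.IsHomogeneous m) (hb : b.IsHomogeneous n) (hab : a * b ∈ X.ideal) :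
    a ∈ X.ideal ∨ b ∈ X.ideal := by
  have key : ∀ {c : HomPoly N} {l : ℕ}, c.IsHomogeneous l →
      X.carrier ⊆ projZeros {c} → c ∈ X.ideal := by
    intro c l hc hX
    rw [mem_ideal]
    rintro v ⟨hv, hvX⟩
    exact eval_eq_zero_of_rep hc hv (hX hvX c rfl)
  have halg : ∀ {c : HomPoly N} {l : ℕ}, c.IsHomogeneous l → IsAlgebraicSet (projZeros {c}) :=
    fun {c l} hc => ⟨{c}, by rintro g rfl; exact ⟨l, hc⟩, rfl⟩
  refine (X.irreducible _ _ (halg ha) (halg hb) ?_).imp (key ha) (key hb)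
  intro p hp
  have h := mem_ideal.mp hab _ (rep_mem_affineCone hp)
  rw [map_mul, mul_eq_zero] at h
  refine h.imp ?_ ?_ <;> · rintro h g rfl; exact h

instance isPrime_ideal (X : ProjVariety N) : X.ideal.IsPrime := by
  let _ := MvPolynomial.gradedAlgebra (σ := Fin (N + 1)) (R := ℂ)
  have hhom : X.ideal.IsHomogeneous (MvPolynomial.homogeneousSubmodule (Fin (N + 1)) ℂ) := by
    intro i g hg
    have h := X.homogeneousComponent_mem hg i
    rwa [← MvPolynomial.decomposition.decompose'_apply] at h
  refine hhom.isPrime_of_homogeneous_mem_or_mem ?_ ?_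
  · rw [Ne, Ideal.eq_top_iff_one, mem_ideal]
    obtain ⟨p, hp⟩ := X.nonempty
    intro h
    simpa using h _ (rep_mem_affineCone hp)
  · rintro a b ⟨m, ha⟩ ⟨n, hb⟩ hab
    exact X.mem_or_mem_of_isHomogeneous ha hb hab

/-- The homogeneous coordinate ring. -/
abbrev coordRing (X : ProjVariety N) : Type := HomPoly N ⧸ X.ideal

/-- `X` has dimension `r`: its homogeneous coordinate ring, that is the coordinate ring of the
affine cone over `X`, has Krull dimension `r + 1`. -/
def HasDim (X : ProjVariety N) (r : ℕ) : Prop :=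
  ringKrullDim X.coordRing = ((r + 1 : ℕ) : WithBot ℕ∞)

/-- The fraction field of the homogeneous coordinate ring. -/
abbrev coneField (X : ProjVariety N) : Type := FractionRing X.coordRing

/-- The class of a polynomial in `X.coneField`. -/
def toConeField (X : ProjVariety N) : HomPoly N →+* X.coneField :=
  (algebraMap X.coordRing X.coneField).comp (Ideal.Quotient.mk X.ideal)

lemma toConeField_eq_zero {X : ProjVariety N} {g : HomPoly N} :
    X.toConeField g = 0 ↔ g ∈ X.ideal := by
  rw [toConeField, RingHom.comp_apply, FaithfulSMul.algebraMap_eq_zero_iff,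
    Ideal.Quotient.eq_zero_iff_mem]

lemma toConeField_C (X : ProjVariety N) (c : ℂ) :
    X.toConeField (MvPolynomial.C c) = algebraMap ℂ X.coneField c := by
  rw [IsScalarTower.algebraMap_apply ℂ X.coordRing X.coneField]
  rfl

/-- The fractions `a / b` of forms of the same degree on `X` whose denominator vanishes identically
neither on `X` nor on `Y`. (For `Y ⊆ X` the first of these two conditions is implied by the
second.) -/
def fractionsAlong (X Y : ProjVariety N) : Subalgebra ℂ X.coneField where
  carrier := {q | ∃ (m : ℕ) (a b : HomPoly N), a.IsHomogeneous m ∧ b.IsHomogeneous m ∧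
    b ∉ X.ideal ∧ b ∉ Y.ideal ∧ q = X.toConeField a / X.toConeField b}
  mul_mem' := by
    rintro _ _ ⟨m, a, b, ha, hb, hX, hY, rfl⟩ ⟨m', a', b', ha', hb', hX', hY', rfl⟩
    refine ⟨m + m', a * a', b * b', ha.mul ha', hb.mul hb',
      X.isPrime_ideal.mul_notMem hX hX', Y.isPrime_ideal.mul_notMem hY hY', ?_⟩
    rw [map_mul, map_mul, div_mul_div_comm]
  add_mem' := by
    rintro _ _ ⟨m, a, b, ha, hb, hX, hY, rfl⟩ ⟨m', a', b', ha', hb', hX', hY', rfl⟩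
    refine ⟨m + m', a * b' + b * a', b * b', (ha.mul hb').add (hb.mul ha'), hb.mul hb',
      X.isPrime_ideal.mul_notMem hX hX', Y.isPrime_ideal.mul_notMem hY hY', ?_⟩
    rw [map_add, map_mul, map_mul, map_mul, div_add_div]
    · rwa [Ne, toConeField_eq_zero]
    · rwa [Ne, toConeField_eq_zero]
  algebraMap_mem' := fun c =>
    ⟨0, MvPolynomial.C c, 1, MvPolynomial.isHomogeneous_C _ _, MvPolynomial.isHomogeneous_one _ _,
      X.isPrime_ideal.one_notMem, Y.isPrime_ideal.one_notMem, by
        rw [map_one, div_one, toConeField_C]⟩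

/-- The field `ℂ(X)` of rational functions on `X`. -/
def functionField (X : ProjVariety N) : IntermediateField ℂ X.coneField where
  toSubalgebra := X.fractionsAlong X
  inv_mem' := by
    rintro _ ⟨m, a, b, ha, hb, hX, -, rfl⟩
    by_cases h : a ∈ X.ideal
    · rw [toConeField_eq_zero.mpr h, zero_div, inv_zero]
      exact (X.fractionsAlong X).zero_mem
    · exact ⟨m, b, a, hb, ha, h, h, inv_div _ _⟩

/-- The local ring `𝒪_{X,Y}` of `X` along an irreducible subvariety `Y ⊆ X`, inside `ℂ(X)`. -/
def localRing (X Y : ProjVariety N) : Subalgebra ℂ X.functionField :=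
  (X.fractionsAlong Y).comap X.functionField.val

/-- The maximal ideal of `𝒪_{X,Y}`: it consists of the fractions `a / b` whose numerator vanishes
on `Y` and whose denominator does not. -/
def maxIdealAlong (X Y : ProjVariety N) : Ideal (X.localRing Y) :=
  Ideal.span {q | ∃ (m : ℕ) (a b : HomPoly N), a.IsHomogeneous m ∧ b.IsHomogeneous m ∧
    a ∈ Y.ideal ∧ b ∉ X.ideal ∧ b ∉ Y.ideal ∧
    ((q : X.functionField) : X.coneField) = X.toConeField a / X.toConeField b}

/-- For `M = dim X`: the rational sections of the line bundle `ω_X^{⊗ (-n)}`. -/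
abbrev RatAnticanonical (X : ProjVariety N) (M n : ℕ) : Type :=
  RatSections X.functionField M n

/-- For `X` smooth of dimension `M`, the module `ω_{X,Y}` of regular `M`-forms along `Y` is generated
over `𝒪_{X,Y}` by the forms `da₁ ∧ ⋯ ∧ da_M` with `aᵢ ∈ 𝒪_{X,Y}`. The section `s` of `ω_X^{⊗ (-n)}`
vanishes along `Y` to order at least `m` when its values on all `n`-tuples of these lie in the
`m`-th power of the maximal ideal of `𝒪_{X,Y}`; equivalently, when a local equation of the divisor
of `s` at the generic point of `Y` lies there. For `m = 0` this says that `s` is regular at the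
generic point of `Y`. -/
def VanishesToOrder (X Y : ProjVariety N) {M n : ℕ} (s : X.RatAnticanonical M n) (m : ℕ) : Prop :=
  ∀ a : Fin n → Fin M → X.localRing Y, ∃ g ∈ X.maxIdealAlong Y ^ m,
    (g : X.functionField) = s.onWedges fun j i => (a j i : X.functionField)

/-- The space `H⁰(X, -nK_X)`, for `X` smooth of dimension `M`: the rational sections of
`ω_X^{⊗ (-n)}` that are regular at every (closed or not) point of `X`. -/
def anticanonicalSections (X : ProjVariety N) (M n : ℕ) :
    Submodule ℂ (X.RatAnticanonical M n) where
  carrier := {s | ∀ Y : ProjVariety N, Y.carrier ⊆ X.carrier → X.VanishesToOrder Y s 0}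
  add_mem' := by
    intro s t hs ht Y hY a
    obtain ⟨g, -, hg⟩ := hs Y hY a
    obtain ⟨h, -, hh⟩ := ht Y hY a
    exact ⟨g + h, by simp, by
      rw [RatSections.onWedges_add, ← hg, ← hh]; rfl⟩
  zero_mem' := fun Y _ a => ⟨0, by simp,
    (RatSections.onWedges_zero (M := M) (n := n) fun j i => (a j i : X.functionField)).symm⟩
  smul_mem' := by
    intro c s hs Y hY a
    obtain ⟨g, -, hg⟩ := hs Y hY a
    exact ⟨c • g, by simp, by
      rw [RatSections.onWedges_smul, ← hg]; rfl⟩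

/-- The multiplicity along `Y` of the divisor of a section (`⊤` for the zero section). -/
def multAlong (X Y : ProjVariety N) {M n : ℕ} (s : X.RatAnticanonical M n) : ℕ∞ :=
  ⨆ (m : ℕ) (_ : X.VanishesToOrder Y s m), (m : ℕ∞)

/-- The multiplicity `mult_Y Σ` of the linear system given by a space `V` of sections. It is the
minimum of the multiplicities of the members, which is the multiplicity of a general member. -/
def multSystem (X Y : ProjVariety N) {M n : ℕ} (V : Submodule ℂ (X.RatAnticanonical M n)) : ℕ∞ :=
  ⨅ s ∈ V, X.multAlong Y s

/-- Prime divisors on `X`. -/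
def IsPrimeDivisor (X Z : ProjVariety N) : Prop :=
  Z.carrier ⊆ X.carrier ∧ ∃ r : ℕ, Z.HasDim r ∧ X.HasDim (r + 1)

/-- `V` defines a non-empty linear subsystem of `|-nK_X|` without fixed components. -/
structure IsMovableSystem (X : ProjVariety N) (M n : ℕ)
    (V : Submodule ℂ (X.RatAnticanonical M n)) : Prop where
  le : V ≤ X.anticanonicalSections M n
  ne_bot : V ≠ ⊥
  no_fixed_component : ∀ Z : ProjVariety N, X.IsPrimeDivisor Z → X.multSystem Z V = 0

end ProjVariety

/-- The form `q_m` in the expansion `f (v + z) = q₀ + q₁(z) + q₂(z) + ⋯` of `f` at `v`. -/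
def taylorForm {N : ℕ} (f : HomPoly N) (v : Fin (N + 1) → ℂ) (m : ℕ) : HomPoly N :=
  MvPolynomial.homogeneousComponent m
    (MvPolynomial.aeval (fun l => MvPolynomial.C (v l) + MvPolynomial.X l) f)

/-- `x` is a regular point of `{f₁ = ⋯ = f_k = 0}`. The point `x = [v]`, `v_j = 1`, is taken as the
origin of the affine chart `{x_j ≠ 0}`, whose linear coordinates are the `z_l`, `l ≠ j`, so that
`z_j = 0` in the expansion `f_i (v + z) = q_{i,1}(z) + ⋯ + q_{i,d_i}(z)`. The equations
`q_{i,m} = 0` with `1 ≤ m ≤ d_i` and `(i, m) ≠ (k, d_k)` are required to define a finite set of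
lines through the origin. -/
def IsRegularPoint {N k : ℕ} (d : Fin k → ℕ) (f : Fin k → HomPoly N) (x : PSpace N) : Prop :=
  ∃ (j : Fin (N + 1)) (v : Fin (N + 1) → ℂ) (hv : v ≠ 0), Projectivization.mk ℂ v hv = x ∧
    v j = 1 ∧
    {p : PSpace N | p.rep j = 0 ∧ ∀ (i : Fin k) (m : ℕ), 1 ≤ m → m ≤ d i →
      ¬ ((i : ℕ) + 1 = k ∧ m = d i) →
      MvPolynomial.eval p.rep (taylorForm (f i) v m) = 0}.Finite

/-- `F` is an irreducible reduced complete intersection `{f₁ = ⋯ = f_k = 0}` of codimension `k` and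
type `(d₁, …, d_k)` in `ℙ^{M+k}`, where `d₁ + ⋯ + d_k = M + k`. -/
structure IsFanoCompleteIntersection (k M : ℕ) (d : Fin k → ℕ) (f : Fin k → HomPoly (M + k))
    (F : ProjVariety (M + k)) : Prop where
  two_le_degree : ∀ i, 2 ≤ d i
  monotone_degree : Monotone d
  sum_degree : ∑ i, d i = M + k
  ne_zero : ∀ i, f i ≠ 0
  isHomogeneous : ∀ i, (f i).IsHomogeneous (d i)
  carrier_eq : F.carrier = projZeros (Set.range f)
  hasDim : F.HasDim M
  /-- The scheme defined by the `f_i` is reduced: in each chart `{x_j ≠ 0}` its ideal is the ideal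
  of all functions vanishing on `F`. -/
  reduced : ∀ g ∈ F.ideal, ∀ j : Fin (M + k + 1), ∃ m : ℕ,
    MvPolynomial.X j ^ m * g ∈ Ideal.span (Set.range f)

/-- Jacobian criterion: the differentials of `f₁, …, f_k` are linearly independent at every common
zero. -/
def IsSmoothCI {N k : ℕ} (f : Fin k → HomPoly N) : Prop :=
  ∀ p ∈ projZeros (Set.range f), LinearIndependent ℂ
    (fun i : Fin k => fun l : Fin (N + 1) => MvPolynomial.eval p.rep (MvPolynomial.pderiv l (f i)))

end

/-
Let `(x, y)` be the generic point of the product of the affine cones over `F` and `Y`, which has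
dimension `(M + 1) + (k + 1) = N + 2` with `N = M + k`. By smoothness of `F` the `N + 1` coordinates
of `p = x - y` are algebraically independent, so over `A = ℂ(p)` the point `(x, y)` still moves, in
a family of affine varieties of positive dimension. Filter its functions by their degree in `y`,
which is also the degree in `x = y + p`.

A point at infinity of this family is a point of `Y` satisfying the polar equations
`∑ p_l ∂_l f_i = 0`. As these are independent for generic `p`, a form `Q` not vanishing on `Y` has
in general no common zero with them, so that every function of large degree is, up to terms of lower
degree, `Q(x)` times another one.

The Jacobian determinants of the `f_i` are the coefficients of the residue form generating the
canonical sheaf; since the index is one, they turn a section of `-nK_F` into a form `g(x)` of degree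
`n`. If it vanishes to order `m` along `Y`, then `Q g` has degree at most `deg Q + n - m` for a
suitable `Q`, because `a(x) = a(x) - a(y)` has degree at most `deg a - 1` for each form `a`
vanishing on `Y`. So for `m > n` multiplication by `g` lowers the degree of every function of large
degree. It then preserves a finite-dimensional space of functions, which forces the `y_i` to be
algebraic over `A`: a contradiction.
-/

open MvPolynomial

section Dimension

lemma ringKrullDim_le_of_hasGoingUp {R S : Type*} [CommRing R] [CommRing S] [Algebra R S]
    [Algebra.HasGoingUp R S]
    (hsurj : Function.Surjective (PrimeSpectrum.comap (algebraMap R S))) :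
    ringKrullDim R ≤ ringKrullDim S := by
  refine iSup_le fun l => ?_
  obtain ⟨P, hP⟩ := hsurj l.head
  have : P.asIdeal.LiesOver l.head.asIdeal := ⟨by rw [← hP]; rfl⟩
  obtain ⟨L, hlen, -⟩ := Ideal.exists_ltSeries_of_hasGoingUp l P.asIdeal
  rw [← hlen]
  exact le_iSup (fun p : LTSeries (PrimeSpectrum S) => (p.length : WithBot ℕ∞)) L

lemma ringKrullDim_eq_of_isIntegral (R S : Type*) [CommRing R] [CommRing S] [Algebra R S]
    [Algebra.IsIntegral R S] [FaithfulSMul R S] : ringKrullDim S = ringKrullDim R :=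
  le_antisymm
    (Order.krullDim_le_of_strictMono (PrimeSpectrum.comap (algebraMap R S)) fun p q hpq =>
      Ideal.IsIntegral.comap_lt_comap (R := R) (I := p.asIdeal) (J := q.asIdeal) hpq)
    (ringKrullDim_le_of_hasGoingUp (Algebra.IsIntegral.comap_surjective R S))

variable (k : Type*) [Field k]

lemma exists_ringKrullDim_eq_and_trdeg_eq (A : Type*) [CommRing A] [IsDomain A] [Algebra k A]
    [Algebra.FiniteType k A] : ∃ s : ℕ, ringKrullDim A = s ∧ Algebra.trdeg k A = s := by
  obtain ⟨s, g, hinj, hint⟩ := exists_integral_inj_algHom_of_fg k A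
  let _ := g.toRingHom.toAlgebra
  have : Algebra.IsIntegral (MvPolynomial (Fin s) k) A := ⟨hint⟩
  have : FaithfulSMul (MvPolynomial (Fin s) k) A :=
    (faithfulSMul_iff_algebraMap_injective _ _).mpr hinj
  have : IsScalarTower k (MvPolynomial (Fin s) k) A :=
    IsScalarTower.of_algebraMap_eq fun c => (g.commutes c).symm
  refine ⟨s, ?_, ?_⟩
  · simp [ringKrullDim_eq_of_isIntegral (MvPolynomial (Fin s) k) A,
      MvPolynomial.ringKrullDim_of_isNoetherianRing]
  · have hadd := lift_trdeg_add_eq k (MvPolynomial (Fin s) k) A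
    rw [trdeg_eq_zero (R := MvPolynomial (Fin s) k) (A := A)] at hadd
    simpa using hadd.symm

variable {k}

lemma ringKrullDim_eq_natCast_iff_trdeg_eq {A : Type*} [CommRing A] [IsDomain A] [Algebra k A]
    [Algebra.FiniteType k A] {r : ℕ} : ringKrullDim A = r ↔ Algebra.trdeg k A = r := by
  obtain ⟨s, hdim, htrdeg⟩ := exists_ringKrullDim_eq_and_trdeg_eq k A
  rw [hdim, htrdeg]
  norm_cast

lemma trdeg_quotient_lt_of_lt {R : Type*} [CommRing R] [Algebra k R] [Algebra.FiniteType k R]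
    {p q : Ideal R} [p.IsPrime] [q.IsPrime] (hpq : p < q) :
    Algebra.trdeg k (R ⧸ q) < Algebra.trdeg k (R ⧸ p) := by
  obtain ⟨r, hr, hr'⟩ := exists_ringKrullDim_eq_and_trdeg_eq k (R ⧸ p)
  obtain ⟨s, hs, hs'⟩ := exists_ringKrullDim_eq_and_trdeg_eq k (R ⧸ q)
  obtain ⟨a, haq, hap⟩ := SetLike.exists_of_lt hpq
  have hne : Ideal.Quotient.mk p a ≠ 0 := by rwa [Ne, Ideal.Quotient.eq_zero_iff_mem]
  have hle := ringKrullDim_succ_le_of_surjective (Ideal.Quotient.factor hpq.le)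
    (Ideal.Quotient.factor_surjective hpq.le) (mem_nonZeroDivisors_of_ne_zero hne)
    (by rwa [Ideal.Quotient.factor_mk, Ideal.Quotient.eq_zero_iff_mem])
  rw [hr, hs] at hle
  rw [hr', hs']
  exact_mod_cast hle

lemma exists_algebraicIndependent_of_ringKrullDim {A : Type*} [CommRing A] [IsDomain A]
    [Algebra k A] [Algebra.FiniteType k A] {r : ℕ} (h : ringKrullDim A = r) :
    ∃ b : Fin r → A, AlgebraicIndependent k b := by
  obtain ⟨ι, b, hb⟩ := exists_isTranscendenceBasis' k A
  have hcard : Cardinal.lift.{0} (Cardinal.mk ι) = Cardinal.lift (Cardinal.mk (Fin r)) := by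
    rw [Cardinal.lift_id'.{0}, hb.cardinalMk_eq_trdeg,
      (ringKrullDim_eq_natCast_iff_trdeg_eq (k := k)).mp h]
    simp
  obtain ⟨e⟩ := Cardinal.lift_mk_eq'.mp hcard
  exact ⟨b ∘ e.symm, hb.1.comp _ e.symm.injective⟩

end Dimension

lemma aeval_mem_graded {κ σ R B S : Type*} [AddCommMonoidWithOne κ] [CommSemiring R]
    [CommSemiring B] [Algebra R B] [SetLike S B] [AddSubmonoidClass S B] (W : κ → S)
    [SetLike.GradedMonoid W] (hW : ∀ c : R, algebraMap R B c ∈ W 0) {x : σ → B}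
    (hx : ∀ i, x i ∈ W 1) {q : MvPolynomial σ R} {e : ℕ} (hq : q.IsHomogeneous e) :
    aeval x q ∈ W e := by
  rw [aeval_def, eval₂_eq]
  refine sum_mem fun m hm => ?_
  have hmon := SetLike.mul_mem_graded (hW (coeff m q))
    (SetLike.prod_pow_mem_graded W (fun _ => 1) x (F := m.support) m fun i _ => hx i)
  rwa [zero_add, ← Finset.sum_smul, nsmul_one, ← hq.degree_eq_sum_deg_support hm] at hmon

lemma map_homogeneousComponent_mem_of_mem_span {σ R Ω : Type*} [CommRing R] [AddCommGroup Ω]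
    (φ : MvPolynomial σ R →+ Ω) (W : ℕ → AddSubgroup Ω) (G : Set (MvPolynomial σ R))
    (h : ∀ g ∈ G, ∃ d₀ : ℕ, g.IsHomogeneous d₀ ∧
      ∀ (d₁ : ℕ) (c : MvPolynomial σ R), c.IsHomogeneous d₁ → φ (c * g) ∈ W (d₁ + d₀))
    {p : MvPolynomial σ R} (hp : p ∈ Ideal.span G) (e : ℕ) :
    φ (homogeneousComponent e p) ∈ W e := by
  induction hp using Submodule.closure_induction with
  | zero => simp
  | add x y _ _ hx hy => rw [map_add, map_add]; exact add_mem hx hy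
  | smul_mem r g hg =>
    obtain ⟨d₀, hd, hW⟩ := h g hg
    rw [smul_eq_mul, ← sum_homogeneousComponent r, Finset.sum_mul, map_sum, map_sum]
    refine sum_mem fun i _ => ?_
    have hi := homogeneousComponent_isHomogeneous i r
    rw [homogeneousComponent_of_mem (hi.mul hd)]
    split_ifs with he
    · rw [he]; exact hW i _ hi
    · simp

lemma derivation_aeval {σ R B M : Type*} [Fintype σ] [CommRing R] [CommRing B] [Algebra R B]
    [AddCommGroup M] [Module R M] [Module B M] (D : Derivation R B M) (x : σ → B)
    (q : MvPolynomial σ R) : D (aeval x q) = ∑ i, aeval x (pderiv i q) • D (x i) := by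
  classical
  induction q using MvPolynomial.induction_on with
  | C a => simp
  | add p q hp hq => simp only [map_add, hp, hq, add_smul, Finset.sum_add_distrib]
  | mul_X p j hp =>
    simp only [map_mul, aeval_X, Derivation.leibniz, hp, smul_eq_mul, pderiv_X, map_add, add_smul,
      Finset.sum_add_distrib, mul_smul, Finset.smul_sum, Pi.single_apply, apply_ite (aeval x),
      map_one, map_zero, ite_smul, one_smul, zero_smul, smul_ite, smul_zero, Finset.sum_ite_eq,
      Finset.mem_univ, if_true]

section DegreeFiltration

/-- The filtration of an `A`-algebra by degree in given elements `y i`: the `A`-span of the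
monomials of degree at most `e`. It is indexed by `ℤ` so that lowering the degree needs
no truncation. -/
def degreeLE (A : Type*) {ι Ω : Type*} [CommRing A] [CommRing Ω] [Algebra A Ω] (y : ι → Ω)
    (e : ℤ) : Submodule A Ω :=
  Submodule.span A {z | ∃ m : ι →₀ ℕ, (m.degree : ℤ) ≤ e ∧ z = m.prod fun i a => y i ^ a}

variable {ι A Ω : Type*} [CommRing A] [CommRing Ω] [Algebra A Ω]

lemma degreeLE_mono (y : ι → Ω) : Monotone (degreeLE A y) :=
  fun _ _ h => Submodule.span_mono fun _ ⟨m, hm, hz⟩ => ⟨m, hm.trans h, hz⟩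

lemma monomial_mem_degreeLE (y : ι → Ω) (m : ι →₀ ℕ) {e : ℤ} (h : (m.degree : ℤ) ≤ e) :
    (m.prod fun i a => y i ^ a) ∈ degreeLE A y e :=
  Submodule.subset_span ⟨m, h, rfl⟩

lemma one_mem_degreeLE (y : ι → Ω) {e : ℤ} (he : 0 ≤ e) : (1 : Ω) ∈ degreeLE A y e := by
  simpa using monomial_mem_degreeLE (A := A) y 0 (e := e) (by simpa using he)

instance gradedMonoid_degreeLE (y : ι → Ω) : SetLike.GradedMonoid (degreeLE A y) where
  one_mem := one_mem_degreeLE y le_rfl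
  mul_mem := by
    intro e e' z w hz hw
    have hle : degreeLE A y e * degreeLE A y e' ≤ degreeLE A y (e + e') := by
      rw [degreeLE, degreeLE, Submodule.span_mul_span, Submodule.span_le]
      rintro _ ⟨_, ⟨m, hm, rfl⟩, _, ⟨m', hm', rfl⟩, rfl⟩
      dsimp only
      rw [← Finsupp.prod_add_index' (fun _ => pow_zero _) (fun _ _ _ => pow_add _ _ _)]
      exact monomial_mem_degreeLE y _ (by rw [map_add]; push_cast; omega)
    exact hle (Submodule.mul_mem_mul hz hw)

lemma mul_mem_degreeLE {y : ι → Ω} {e e' e'' : ℤ} {z w : Ω} (hz : z ∈ degreeLE A y e)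
    (hw : w ∈ degreeLE A y e') (h : e + e' ≤ e'') : z * w ∈ degreeLE A y e'' :=
  degreeLE_mono y h (SetLike.mul_mem_graded hz hw)

lemma algebraMap_mem_degreeLE (y : ι → Ω) (a : A) {e : ℤ} (he : 0 ≤ e) :
    algebraMap A Ω a ∈ degreeLE A y e := by
  rw [Algebra.algebraMap_eq_smul_one]
  exact Submodule.smul_mem _ _ (one_mem_degreeLE y he)

lemma self_mem_degreeLE (y : ι → Ω) (i : ι) : y i ∈ degreeLE A y 1 := by
  simpa using monomial_mem_degreeLE (A := A) y (Finsupp.single i 1) (e := 1) (by simp)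

lemma monomial_mem_degreeLE_of_mem {x y : ι → Ω} (h : ∀ i, x i ∈ degreeLE A y 1) (m : ι →₀ ℕ) :
    (m.prod fun i a => x i ^ a) ∈ degreeLE A y m.degree := by
  have hmem := SetLike.prod_pow_mem_graded (degreeLE A y) (fun _ => 1) x (F := m.support) m
    fun i _ => h i
  rw [← Finset.sum_smul, nsmul_one] at hmem
  exact hmem

lemma degreeLE_le_of_mem {x y : ι → Ω} (h : ∀ i, x i ∈ degreeLE A y 1) (e : ℤ) :
    degreeLE A x e ≤ degreeLE A y e := by
  refine Submodule.span_le.mpr ?_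
  rintro _ ⟨m, hm, rfl⟩
  exact degreeLE_mono y hm (monomial_mem_degreeLE_of_mem h m)

lemma fg_degreeLE [Finite ι] (y : ι → Ω) (e : ℤ) : (degreeLE A y e).FG := by
  refine Submodule.fg_span <| ((Finsupp.finite_of_degree_le (σ := ι) e.toNat).image
    fun m => m.prod fun i a => y i ^ a).subset ?_
  rintro _ ⟨m, hm, rfl⟩
  exact ⟨m, by rw [Set.mem_ofPred_eq]; omega, rfl⟩

lemma exists_mem_degreeLE_of_mem_adjoin {y : ι → Ω} {z : Ω}
    (hz : z ∈ Algebra.adjoin A (Set.range y)) : ∃ e : ℕ, z ∈ degreeLE A y e := by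
  induction hz using Algebra.adjoin_induction with
  | mem z hz => obtain ⟨i, rfl⟩ := hz; exact ⟨1, self_mem_degreeLE y i⟩
  | algebraMap a => exact ⟨0, algebraMap_mem_degreeLE y a le_rfl⟩
  | add z w _ _ hz hw =>
    obtain ⟨e, he⟩ := hz
    obtain ⟨e', he'⟩ := hw
    exact ⟨e + e', add_mem (degreeLE_mono y (by omega) he) (degreeLE_mono y (by omega) he')⟩
  | mul z w _ _ hz hw =>
    obtain ⟨e, he⟩ := hz
    obtain ⟨e', he'⟩ := hw
    exact ⟨e + e', mul_mem_degreeLE he he' (by push_cast; rfl)⟩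

section Translation

variable {x y : ι → Ω} {p : ι → A}

lemma mem_degreeLE_one_of_eq_add (hx : ∀ i, x i = y i + algebraMap A Ω (p i)) (i : ι) :
    x i ∈ degreeLE A y 1 := by
  rw [hx]
  exact add_mem (self_mem_degreeLE y i) (algebraMap_mem_degreeLE y _ zero_le_one)

lemma degreeLE_eq_of_eq_add (hx : ∀ i, x i = y i + algebraMap A Ω (p i)) :
    degreeLE A x = degreeLE A y :=
  funext fun e => le_antisymm (degreeLE_le_of_mem (mem_degreeLE_one_of_eq_add hx) e)
    (degreeLE_le_of_mem
      (mem_degreeLE_one_of_eq_add (p := -p) fun i => by simp [hx i]) e)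

end Translation

variable {R : Type*} [CommRing R] [Algebra R A] [Algebra R Ω] [IsScalarTower R A Ω]

lemma algebraMap_mem_degreeLE_of_tower (y : ι → Ω) (c : R) {e : ℤ} (he : 0 ≤ e) :
    algebraMap R Ω c ∈ degreeLE A y e := by
  rw [IsScalarTower.algebraMap_apply R A Ω]
  exact algebraMap_mem_degreeLE y _ he

lemma aeval_mem_degreeLE {x y : ι → Ω} (h : ∀ i, x i ∈ degreeLE A y 1) {q : MvPolynomial ι R}
    {e : ℕ} (hq : q.IsHomogeneous e) : aeval x q ∈ degreeLE A y e :=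
  aeval_mem_graded (degreeLE A y) (fun c => algebraMap_mem_degreeLE_of_tower y c le_rfl) h hq

end DegreeFiltration

section Taylor

/-- The polynomial `q (y + T v)` in `T`: the restriction of `q` to the line through `y` in
direction `v`. -/
noncomputable def restrictToLine {ι R Ω : Type*} [CommRing R] [CommRing Ω] [Algebra R Ω]
    (y v : ι → Ω) (q : MvPolynomial ι R) : Polynomial Ω :=
  aeval (fun i => Polynomial.C (y i) + Polynomial.C (v i) * Polynomial.X) q

variable {ι R A Ω : Type*} [CommRing R] [CommRing A] [CommRing Ω] [Algebra R Ω] [Algebra A Ω]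

lemma eval_restrictToLine (y v : ι → Ω) (q : MvPolynomial ι R) (t : Ω) :
    (restrictToLine y v q).eval t = aeval (fun i => y i + v i * t) q := by
  have h := comp_aeval_apply (fun i => Polynomial.C (y i) + Polynomial.C (v i) * Polynomial.X)
    ((Polynomial.aeval t : Polynomial Ω →ₐ[Ω] Ω).restrictScalars R) q
  simpa [restrictToLine] using h

lemma coeff_zero_restrictToLine (y v : ι → Ω) (q : MvPolynomial ι R) :
    (restrictToLine y v q).coeff 0 = aeval y q := by
  rw [Polynomial.coeff_zero_eq_eval_zero, eval_restrictToLine]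
  simp

lemma coeff_one_restrictToLine [Fintype ι] (y v : ι → Ω) (q : MvPolynomial ι R) :
    (restrictToLine y v q).coeff 1 = ∑ l, aeval y (pderiv l q) * v l := by
  have hchain : Polynomial.derivative (restrictToLine y v q) =
      ∑ l, restrictToLine y v (pderiv l q) * Polynomial.C (v l) := by
    refine (derivation_aeval (M := Polynomial Ω)
      (Polynomial.derivative'.restrictScalars R) _ q).trans (Finset.sum_congr rfl fun l _ => ?_)
    change _ • Polynomial.derivative _ = _
    simp [restrictToLine]
  have hcoeff := Polynomial.coeff_derivative (restrictToLine y v q) 0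
  simpa [hchain, coeff_zero_restrictToLine] using hcoeff.symm

/-- The polynomials whose `j`-th coefficient has degree at most `e - j` in `y`: the weight
filtration in which the variable has degree `1`. -/
def weightLE (A : Type*) {ι Ω : Type*} [CommRing A] [CommRing Ω] [Algebra A Ω] (y : ι → Ω)
    (e : ℤ) : AddSubmonoid (Polynomial Ω) where
  carrier := {F | ∀ j : ℕ, F.coeff j ∈ degreeLE A y (e - j)}
  zero_mem' := by simp
  add_mem' hF hG j := by
    rw [Polynomial.coeff_add]
    exact add_mem (hF j) (hG j)

instance gradedMonoid_weightLE (y : ι → Ω) : SetLike.GradedMonoid (weightLE A y) where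
  one_mem j := by
    rw [Polynomial.coeff_one]
    split_ifs with hj
    · exact one_mem_degreeLE y (by simp [hj])
    · exact zero_mem _
  mul_mem e e' F G hF hG j := by
    rw [Polynomial.coeff_mul]
    refine sum_mem fun ab hab => mul_mem_degreeLE (hF ab.1) (hG ab.2) ?_
    have hj : ab.1 + ab.2 = j := Finset.HasAntidiagonal.mem_antidiagonal.mp hab
    omega

variable [Algebra R A] [IsScalarTower R A Ω]

lemma restrictToLine_mem_weightLE (y : ι → Ω) (p : ι → A) {q : MvPolynomial ι R} {e : ℕ}
    (hq : q.IsHomogeneous e) :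
    restrictToLine y (fun i => algebraMap A Ω (p i)) q ∈ weightLE A y e := by
  refine aeval_mem_graded (weightLE A y) (fun c j => ?_) (fun i j => ?_) hq
  · rw [Polynomial.algebraMap_apply, Polynomial.coeff_C]
    split_ifs with hj
    · exact algebraMap_mem_degreeLE_of_tower y c (by simp [hj])
    · exact zero_mem _
  · match j with
    | 0 => simpa using self_mem_degreeLE y i
    | 1 => simpa using algebraMap_mem_degreeLE y (p i) le_rfl
    | j + 2 => simp [Polynomial.coeff_C_succ]

/-- Taylor expansion at `y` of a form at the translate `x = y + p`, with remainder of order `r`. -/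
lemma aeval_sub_sum_coeff_mem_degreeLE {x y : ι → Ω} {p : ι → A}
    (hx : ∀ i, x i = y i + algebraMap A Ω (p i)) {q : MvPolynomial ι R} {e : ℕ}
    (hq : q.IsHomogeneous e) (r : ℕ) :
    aeval x q - ∑ j ∈ Finset.range r, (restrictToLine y (fun i => algebraMap A Ω (p i)) q).coeff j ∈
      degreeLE A y (e - r) := by
  set F := restrictToLine y (fun i => algebraMap A Ω (p i)) q
  have hF : aeval x q = F.eval 1 := by simp [F, eval_restrictToLine, funext hx]
  rw [hF, Polynomial.eval_eq_sum_range' (n := r + (F.natDegree + 1)) (by omega),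
    Finset.sum_range_add]
  simp only [one_pow, mul_one, add_sub_cancel_left]
  exact sum_mem fun j _ =>
    degreeLE_mono y (by omega) (restrictToLine_mem_weightLE y p hq (r + j))

lemma aeval_sub_aeval_mem_degreeLE {x y : ι → Ω} {p : ι → A}
    (hx : ∀ i, x i = y i + algebraMap A Ω (p i)) {q : MvPolynomial ι R} {e : ℕ}
    (hq : q.IsHomogeneous e) : aeval x q - aeval y q ∈ degreeLE A y (e - 1) := by
  simpa [coeff_zero_restrictToLine] using aeval_sub_sum_coeff_mem_degreeLE hx hq 1

lemma aeval_sub_aeval_sub_sum_pderiv_mem_degreeLE [Fintype ι] {x y : ι → Ω} {p : ι → A}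
    (hx : ∀ i, x i = y i + algebraMap A Ω (p i)) {q : MvPolynomial ι R} {e : ℕ}
    (hq : q.IsHomogeneous e) :
    aeval x q - aeval y q - ∑ l, aeval y (pderiv l q) * algebraMap A Ω (p l) ∈
      degreeLE A y (e - 2) := by
  simpa [Finset.sum_range_succ, sub_sub, coeff_zero_restrictToLine, coeff_one_restrictToLine] using
    aeval_sub_sum_coeff_mem_degreeLE hx hq 2

end Taylor

section Stability

lemma prod_pow_eq_pow_mul_prod_sub {ι Ω : Type*} [CommRing Ω] (y : ι → Ω) {m : ι →₀ ℕ} {r : ℕ}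
    {j : ι} (h : r ≤ m j) :
    (m.prod fun i a => y i ^ a) =
      y j ^ r * (m - Finsupp.single j r).prod fun i a => y i ^ a := by
  conv_lhs => rw [← add_tsub_cancel_of_le (Finsupp.single_le_iff.mpr h)]
  rw [Finsupp.prod_add_index' (fun _ => pow_zero _) (fun _ _ _ => pow_add _ _ _),
    Finsupp.prod_single_index (h := fun i a => y i ^ a) (pow_zero _)]

lemma degree_sub_single_add {ι : Type*} {m : ι →₀ ℕ} {r : ℕ} {j : ι} (h : r ≤ m j) :
    (m - Finsupp.single j r).degree + r = m.degree := by
  conv_rhs => rw [← add_tsub_cancel_of_le (Finsupp.single_le_iff.mpr h)]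
  rw [map_add, Finsupp.degree_single, add_comm]

variable {ι A Ω : Type*}

lemma exists_le_apply_of_lt_degree [Fintype ι] {m : ι →₀ ℕ} {r : ℕ}
    (h : Fintype.card ι * r < m.degree) : ∃ j, r ≤ m j := by
  by_contra! hlt
  rw [Finsupp.degree_eq_sum] at h
  have hle : ∑ i, m i ≤ ∑ _i : ι, r := Finset.sum_le_sum fun i _ => (hlt i).le
  rw [Finset.sum_const, Finset.card_univ, smul_eq_mul] at hle
  omega

lemma exists_sum_pow_mul_eq_one {B : Type*} [CommRing A] [CommRing B] [Algebra A B] [Fintype ι]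
    {S : Subalgebra A B} {x c : ι → B} (hx : ∀ i, x i ∈ S) (hc : ∀ i, c i ∈ S)
    (hsum : ∑ i, x i * c i = 1) (s : ℕ) : ∃ b : ι → B, (∀ i, b i ∈ S) ∧ ∑ i, x i ^ s * b i = 1 := by
  let x' : ι → S := fun i => ⟨x i, hx i⟩
  have htop : Ideal.span (Set.range x') = ⊤ := by
    rw [Ideal.eq_top_iff_one, Ideal.mem_span_range_iff_exists_fun]
    refine ⟨fun i => ⟨c i, hc i⟩, Subtype.ext ?_⟩
    rw [AddSubmonoidClass.coe_finsetSum]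
    simpa [x', mul_comm] using hsum
  have htop' := Ideal.span_pow_eq_top _ htop s
  rw [← Set.range_comp, Ideal.eq_top_iff_one, Ideal.mem_span_range_iff_exists_fun] at htop'
  obtain ⟨b, hb⟩ := htop'
  refine ⟨fun i => b i, fun i => (b i).2, ?_⟩
  have hb' := congrArg Subtype.val hb
  rw [AddSubmonoidClass.coe_finsetSum] at hb'
  simpa [x', mul_comm] using hb'

section CommRing

variable [Fintype ι] [CommRing A] [CommRing Ω] [Algebra A Ω]

lemma degreeLE_le_map_sup_sub_one {y : ι → Ω} {Q : Ω} {δ : ℤ} {r : ℕ}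
    (h : ∀ j, y j ^ r ∈
      (degreeLE A y (r - δ)).map (LinearMap.mulLeft A Q) ⊔ degreeLE A y (r - 1))
    {e : ℤ} (he : Fintype.card ι * r < e) :
    degreeLE A y e ≤ (degreeLE A y (e - δ)).map (LinearMap.mulLeft A Q) ⊔ degreeLE A y (e - 1) := by
  refine Submodule.span_le.mpr ?_
  rintro _ ⟨m, hm, rfl⟩
  rcases hm.lt_or_eq with hlt | rfl
  · exact Submodule.mem_sup_right (monomial_mem_degreeLE y m (by omega))
  · obtain ⟨j, hj⟩ := exists_le_apply_of_lt_degree (m := m) (r := r) (by exact_mod_cast he)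
    have hdeg := degree_sub_single_add hj
    have hrest := monomial_mem_degreeLE (A := A) y (m - Finsupp.single j r) le_rfl
    obtain ⟨_, ⟨c, hc, rfl⟩, w, hw, hcw⟩ := Submodule.mem_sup.mp (h j)
    rw [SetLike.mem_coe, prod_pow_eq_pow_mul_prod_sub y hj, ← hcw, add_mul]
    refine Submodule.add_mem_sup ⟨c * _, mul_mem_degreeLE hc hrest (by omega), ?_⟩
      (mul_mem_degreeLE hw hrest (by omega))
    simp only [LinearMap.mulLeft_apply, mul_assoc]

lemma degreeLE_le_map_sup {y : ι → Ω} {Q : Ω} {δ : ℤ} {r : ℕ}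
    (h : ∀ j, y j ^ r ∈
      (degreeLE A y (r - δ)).map (LinearMap.mulLeft A Q) ⊔ degreeLE A y (r - 1))
    (i : ℕ) {e : ℤ} (he : Fintype.card ι * r + i < e) :
    degreeLE A y e ≤ (degreeLE A y (e - δ)).map (LinearMap.mulLeft A Q) ⊔ degreeLE A y (e - i) := by
  induction i with
  | zero => simp
  | succ i ih =>
    push_cast at he
    refine (ih (by linarith)).trans (sup_le le_sup_left
      ((degreeLE_le_map_sup_sub_one h (e := e - i) (by linarith)).trans (sup_le_sup ?_ ?_)))
    · exact Submodule.map_mono (degreeLE_mono y (by omega))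
    · exact degreeLE_mono y (by push_cast; omega)

lemma exists_forall_mul_mem_degreeLE {x y : ι → Ω} {p : ι → A}
    (hx : ∀ i, x i = y i + algebraMap A Ω (p i)) {g : Ω} {n s : ℕ}
    (hg : ∀ j, x j ^ s * g ∈ degreeLE A y (s + n))
    {c : ι → Ω} (hc : ∀ i, c i ∈ Algebra.adjoin A (Set.range y)) (hsum : ∑ i, x i * c i = 1) :
    ∃ e₀ : ℤ, ∀ e ≥ e₀, ∀ z ∈ degreeLE A y e, g * z ∈ degreeLE A y (e + n) := by
  have hxadj : ∀ i, x i ∈ Algebra.adjoin A (Set.range y) := fun i => by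
    rw [hx]
    exact add_mem (Algebra.subset_adjoin ⟨i, rfl⟩) (Subalgebra.algebraMap_mem _ _)
  obtain ⟨b, hb, hbsum⟩ := exists_sum_pow_mul_eq_one hxadj hc hsum s
  choose E hE using fun i => exists_mem_degreeLE_of_mem_adjoin (hb i)
  rw [← degreeLE_eq_of_eq_add hx] at hg ⊢
  simp only [← degreeLE_eq_of_eq_add hx] at hE
  refine ⟨s + ∑ i, E i + Fintype.card ι * s, fun e he => ?_⟩
  suffices hle : degreeLE A x e ≤ (degreeLE A x (e + n)).comap (LinearMap.mulLeft A g) from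
    fun z hz => hle hz
  refine Submodule.span_le.mpr ?_
  rintro _ ⟨m, hm, rfl⟩
  rw [SetLike.mem_coe, Submodule.mem_comap, LinearMap.mulLeft_apply]
  by_cases hdeg : Fintype.card ι * s < m.degree
  · obtain ⟨j, hj⟩ := exists_le_apply_of_lt_degree hdeg
    have hdeg_sub := degree_sub_single_add hj
    rw [prod_pow_eq_pow_mul_prod_sub x hj, ← mul_assoc, mul_comm g]
    exact mul_mem_degreeLE (hg j) (monomial_mem_degreeLE x _ le_rfl) (by omega)
  · have hsplit : g * (m.prod fun i a => x i ^ a) =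
        ∑ i, (x i ^ s * g) * (b i * m.prod fun i a => x i ^ a) := by
      rw [← one_mul (g * _), ← hbsum, Finset.sum_mul]
      exact Finset.sum_congr rfl fun i _ => by ring
    rw [hsplit]
    refine sum_mem fun i _ => mul_mem_degreeLE (hg i)
      (mul_mem_degreeLE (hE i) (monomial_mem_degreeLE x m le_rfl) le_rfl) ?_
    have hEi : E i ≤ ∑ i, E i :=
      Finset.single_le_sum (fun _ _ => Nat.zero_le _) (Finset.mem_univ i)
    rw [not_lt] at hdeg
    zify at hEi hdeg
    push_cast at he
    linarith

end CommRing

variable [Field A] [Field Ω] [Algebra A Ω]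

lemma isAlgebraic_of_mul_mem_degreeLE [Finite ι] {y : ι → Ω} {g : Ω} (hg : g ≠ 0) {e : ℤ}
    (he : 0 ≤ e) (h : ∀ z ∈ degreeLE A y e, g * z ∈ degreeLE A y (e - 1)) (i : ι) :
    IsAlgebraic A (y i) := by
  have hne : degreeLE A y e ≠ ⊥ := fun h0 => one_ne_zero
    ((Submodule.mem_bot A).mp (h0 ▸ one_mem_degreeLE (A := A) y he))
  have hint : ∀ u : Ω, (∀ z ∈ degreeLE A y e, u * z ∈ degreeLE A y e) → IsIntegral A u := fun u =>
    isIntegral_of_smul_mem_submodule (degreeLE A y e) hne (fg_degreeLE y e) u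
  have hgint : IsIntegral A g := hint g fun z hz => degreeLE_mono y (by omega) (h z hz)
  have hygint : IsIntegral A (y i * g) := hint _ fun z hz => by
    rw [mul_assoc]
    exact mul_mem_degreeLE (self_mem_degreeLE y i) (h z hz) (by omega)
  rw [← mul_inv_cancel_right₀ hg (y i)]
  exact hygint.isAlgebraic.mul hgint.isAlgebraic.inv

lemma isAlgebraic_of_mul_mem_degreeLE_of_lt [Fintype ι] {x y : ι → Ω} {p : ι → A}
    (hx : ∀ i, x i = y i + algebraMap A Ω (p i)) {g Q : Ω} (hg0 : g ≠ 0) {n m s r : ℕ} {δ : ℤ}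
    (hnm : n < m) (hQg : Q * g ∈ degreeLE A y (δ + n - m))
    (hQ : ∀ j, y j ^ r ∈
      (degreeLE A y (r - δ)).map (LinearMap.mulLeft A Q) ⊔ degreeLE A y (r - 1))
    (hg : ∀ j, x j ^ s * g ∈ degreeLE A y (s + n))
    {c : ι → Ω} (hc : ∀ i, c i ∈ Algebra.adjoin A (Set.range y)) (hsum : ∑ i, x i * c i = 1)
    (i : ι) : IsAlgebraic A (y i) := by
  obtain ⟨e₀, he₀⟩ := exists_forall_mul_mem_degreeLE hx hg hc hsum
  have hpos : (0 : ℤ) ≤ Fintype.card ι * r := by positivity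
  let e : ℤ := Fintype.card ι * r + m + 1 + |e₀|
  have habs := le_abs_self e₀
  have habs' := abs_nonneg e₀
  refine isAlgebraic_of_mul_mem_degreeLE hg0 (e := e) (by positivity) (fun z hz => ?_) i
  obtain ⟨_, ⟨c, hc, rfl⟩, w, hw, rfl⟩ := Submodule.mem_sup.mp
    (degreeLE_le_map_sup hQ m (e := e) (by simp only [e]; linarith) hz)
  rw [mul_add, LinearMap.mulLeft_apply, ← mul_assoc, mul_comm g Q]
  exact add_mem (mul_mem_degreeLE hQg hc (by omega))
    (degreeLE_mono y (by omega) (he₀ (e - m) (by simp only [e]; linarith) w hw))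

end Stability

section ProductOfSets

variable {σ τ K : Type*} [Field K]

/-- The restriction of a polynomial in two groups of variables to a fixed value of the first. -/
noncomputable def fixLeft (v : σ → K) : MvPolynomial (σ ⊕ τ) K →ₐ[K] MvPolynomial τ K :=
  aeval (Sum.elim (fun i => C (v i)) X)

/-- The restriction of a polynomial in two groups of variables to a fixed value of the second. -/
noncomputable def fixRight (w : τ → K) : MvPolynomial (σ ⊕ τ) K →ₐ[K] MvPolynomial σ K :=
  aeval (Sum.elim X (fun i => C (w i)))

lemma eval_fixLeft (v : σ → K) (w : τ → K) (q : MvPolynomial (σ ⊕ τ) K) :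
    eval w (fixLeft v q) = eval (Sum.elim v w) q := by
  rw [fixLeft, ← aeval_eq_eval, comp_aeval_apply, ← aeval_eq_eval]
  congr 2
  ext (i | i) <;> simp

lemma eval_fixRight (v : σ → K) (w : τ → K) (q : MvPolynomial (σ ⊕ τ) K) :
    eval v (fixRight w q) = eval (Sum.elim v w) q := by
  rw [fixRight, ← aeval_eq_eval, comp_aeval_apply, ← aeval_eq_eval]
  congr 2
  ext (i | i) <;> simp

lemma nonempty_of_isPrime_vanishingIdeal {V : Set (σ → K)} (hV : (vanishingIdeal K V).IsPrime) :
    V.Nonempty := by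
  rw [Set.nonempty_iff_ne_empty]
  rintro rfl
  exact hV.ne_top vanishingIdeal_empty

variable {V : Set (σ → K)} {W : Set (τ → K)}

lemma mem_vanishingIdeal_image2_sumElim {q : MvPolynomial (σ ⊕ τ) K} :
    q ∈ vanishingIdeal K (Set.image2 Sum.elim V W) ↔
      ∀ v ∈ V, ∀ w ∈ W, eval (Sum.elim v w) q = 0 := by
  rw [mem_vanishingIdeal_iff, Set.forall_mem_image2]
  simp only [aeval_eq_eval]

lemma isPrime_vanishingIdeal_image2_sumElim (hV : (vanishingIdeal K V).IsPrime)
    (hW : (vanishingIdeal K W).IsPrime) :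
    (vanishingIdeal K (Set.image2 Sum.elim V W)).IsPrime := by
  have hright : ∀ {q : MvPolynomial (σ ⊕ τ) K} {v w}, v ∈ V → eval (Sum.elim v w) q ≠ 0 →
      fixRight w q ∉ vanishingIdeal K V := fun hv hne h => hne <| by
    simpa only [aeval_eq_eval, eval_fixRight] using mem_vanishingIdeal_iff.mp h _ hv
  have hleft : ∀ {q : MvPolynomial (σ ⊕ τ) K} {v w}, w ∈ W → eval (Sum.elim v w) q ≠ 0 →
      fixLeft v q ∉ vanishingIdeal K W := fun hw hne h => hne <| by
    simpa only [aeval_eq_eval, eval_fixLeft] using mem_vanishingIdeal_iff.mp h _ hw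
  refine ⟨fun h => ?_, fun {p q} hpq => ?_⟩
  · obtain ⟨v, hv⟩ := nonempty_of_isPrime_vanishingIdeal hV
    obtain ⟨w, hw⟩ := nonempty_of_isPrime_vanishingIdeal hW
    rw [Ideal.eq_top_iff_one, mem_vanishingIdeal_image2_sumElim] at h
    simpa using h v hv w hw
  · by_contra! hcon
    simp only [mem_vanishingIdeal_image2_sumElim, not_forall] at hcon
    obtain ⟨⟨v₀, hv₀, w₀, hw₀, h₀⟩, v₁, hv₁, w₁, hw₁, h₁⟩ := hcon
    have hmul := hV.mul_notMem (hright hv₀ h₀) (hright hv₁ h₁)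
    simp only [mem_vanishingIdeal_iff, aeval_eq_eval, not_forall, map_mul, eval_fixRight] at hmul
    obtain ⟨v, hv, hne⟩ := hmul
    refine hW.mul_notMem (hleft hw₀ (left_ne_zero_of_mul hne))
      (hleft hw₁ (right_ne_zero_of_mul hne)) (mem_vanishingIdeal_iff.mpr fun w hw => ?_)
    rw [← map_mul, aeval_eq_eval, eval_fixLeft]
    exact mem_vanishingIdeal_image2_sumElim.mp hpq v hv w hw

lemma algebraicIndependent_mk_vanishingIdeal {ι : Type*} {f : ι → MvPolynomial σ K} :
    AlgebraicIndependent K (fun i => Ideal.Quotient.mk (vanishingIdeal K V) (f i)) ↔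
      ∀ R : MvPolynomial ι K, (∀ v ∈ V, eval (fun i => eval v (f i)) R = 0) → R = 0 := by
  rw [algebraicIndependent_iff]
  refine forall_congr' fun R => imp_congr_left ?_
  change aeval (fun i => Ideal.Quotient.mkₐ K (vanishingIdeal K V) (f i)) R = 0 ↔ _
  rw [← comp_aeval_apply, Ideal.Quotient.mkₐ_eq_mk, Ideal.Quotient.eq_zero_iff_mem,
    mem_vanishingIdeal_iff]
  simp only [comp_aeval_apply, aeval_eq_eval]

lemma algebraicIndependent_sumElim_rename [Infinite K] {ι κ : Type*} {f : ι → MvPolynomial σ K}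
    {g : κ → MvPolynomial τ K}
    (hf : AlgebraicIndependent K fun i => Ideal.Quotient.mk (vanishingIdeal K V) (f i))
    (hg : AlgebraicIndependent K fun i => Ideal.Quotient.mk (vanishingIdeal K W) (g i)) :
    AlgebraicIndependent K fun i => Ideal.Quotient.mk (vanishingIdeal K (Set.image2 Sum.elim V W))
      (Sum.elim (fun i => rename Sum.inl (f i)) (fun i => rename Sum.inr (g i)) i) := by
  rw [algebraicIndependent_mk_vanishingIdeal] at hf hg ⊢
  intro R hR
  have hfst : ∀ w ∈ W, fixRight (fun i => eval w (g i)) R = 0 := fun w hw => hf _ fun v hv => by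
    rw [eval_fixRight, ← hR _ (Set.mem_image2_of_mem hv hw)]
    refine congrArg (fun u => eval u R) (funext ?_)
    rintro (i | i) <;> simp [eval_rename]
  have hsnd : ∀ u : ι → K, fixLeft u R = 0 := fun u => hg _ fun w hw => by
    rw [eval_fixLeft, ← eval_fixRight, hfst w hw, map_zero]
  refine MvPolynomial.funext fun u => ?_
  rw [← Sum.elim_comp_inl_inr u, ← eval_fixLeft, hsnd, map_zero, map_zero]

end ProductOfSets

namespace ProjVariety

noncomputable section

variable {N : ℕ}

/-- The ideal of the product of the affine cones over two projective varieties. -/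
def prodIdeal (X Z : ProjVariety N) : Ideal (MvPolynomial (Fin (N + 1) ⊕ Fin (N + 1)) ℂ) :=
  vanishingIdeal ℂ (Set.image2 Sum.elim (affineCone X.carrier) (affineCone Z.carrier))

lemma affineCone_nonempty (X : ProjVariety N) : (affineCone X.carrier).Nonempty :=
  let ⟨_, hp⟩ := X.nonempty
  ⟨_, rep_mem_affineCone hp⟩

instance isPrime_prodIdeal (X Z : ProjVariety N) : (X.prodIdeal Z).IsPrime :=
  isPrime_vanishingIdeal_image2_sumElim X.isPrime_ideal Z.isPrime_ideal

/-- The function field of the product of the affine cones over two varieties. -/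
abbrev prodField (X Z : ProjVariety N) : Type :=
  FractionRing (MvPolynomial (Fin (N + 1) ⊕ Fin (N + 1)) ℂ ⧸ X.prodIdeal Z)

/-- The generic point of the cone over the first factor. -/
def genFst (X Z : ProjVariety N) (i : Fin (N + 1)) : X.prodField Z :=
  algebraMap _ _ (Ideal.Quotient.mk (X.prodIdeal Z) (MvPolynomial.X (Sum.inl i)))

/-- The generic point of the cone over the second factor. -/
def genSnd (X Z : ProjVariety N) (i : Fin (N + 1)) : X.prodField Z :=
  algebraMap _ _ (Ideal.Quotient.mk (X.prodIdeal Z) (MvPolynomial.X (Sum.inr i)))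

lemma aeval_gen_eq (X Z : ProjVariety N) (q : MvPolynomial (Fin (N + 1) ⊕ Fin (N + 1)) ℂ) :
    aeval (Sum.elim (X.genFst Z) (X.genSnd Z)) q =
      algebraMap _ (X.prodField Z) (Ideal.Quotient.mk (X.prodIdeal Z) q) := by
  have h : aeval (Sum.elim (X.genFst Z) (X.genSnd Z)) =
      (IsScalarTower.toAlgHom ℂ (MvPolynomial (Fin (N + 1) ⊕ Fin (N + 1)) ℂ ⧸ X.prodIdeal Z)
        (X.prodField Z)).comp (Ideal.Quotient.mkₐ ℂ (X.prodIdeal Z)) := by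
    refine MvPolynomial.algHom_ext fun i => ?_
    rw [aeval_X]
    cases i <;> rfl
  rw [h]
  rfl

lemma aeval_gen_eq_zero {X Z : ProjVariety N} {q : MvPolynomial (Fin (N + 1) ⊕ Fin (N + 1)) ℂ} :
    aeval (Sum.elim (X.genFst Z) (X.genSnd Z)) q = 0 ↔
      ∀ v ∈ affineCone X.carrier, ∀ w ∈ affineCone Z.carrier, eval (Sum.elim v w) q = 0 := by
  rw [aeval_gen_eq, FaithfulSMul.algebraMap_eq_zero_iff, Ideal.Quotient.eq_zero_iff_mem, prodIdeal,
    mem_vanishingIdeal_image2_sumElim]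

lemma aeval_genFst_eq_zero {X Z : ProjVariety N} {q : HomPoly N} :
    aeval (X.genFst Z) q = 0 ↔ q ∈ X.ideal := by
  have h : aeval (X.genFst Z) q =
      aeval (Sum.elim (X.genFst Z) (X.genSnd Z)) (rename Sum.inl q) := by
    rw [aeval_rename, Sum.elim_comp_inl]
  obtain ⟨w, hw⟩ := Z.affineCone_nonempty
  simp only [h, aeval_gen_eq_zero, mem_ideal, eval_rename, Sum.elim_comp_inl]
  exact ⟨fun h v hv => h v hv w hw, fun h v hv _ _ => h v hv⟩

lemma aeval_genSnd_eq_zero {X Z : ProjVariety N} {q : HomPoly N} :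
    aeval (X.genSnd Z) q = 0 ↔ q ∈ Z.ideal := by
  have h : aeval (X.genSnd Z) q =
      aeval (Sum.elim (X.genFst Z) (X.genSnd Z)) (rename Sum.inr q) := by
    rw [aeval_rename, Sum.elim_comp_inr]
  obtain ⟨v, hv⟩ := X.affineCone_nonempty
  simp only [h, aeval_gen_eq_zero, mem_ideal, eval_rename, Sum.elim_comp_inr]
  exact ⟨fun h w hw => h v hv w hw, fun h _ _ w hw => h w hw⟩

lemma HasDim.exists_algebraicIndependent {X : ProjVariety N} {a : ℕ} (ha : X.HasDim a) :
    ∃ f : Fin (a + 1) → HomPoly N,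
      AlgebraicIndependent ℂ fun i => Ideal.Quotient.mk X.ideal (f i) := by
  obtain ⟨b, hb⟩ := exists_algebraicIndependent_of_ringKrullDim (k := ℂ) ha
  choose f hf using fun i => Ideal.Quotient.mk_surjective (b i)
  exact ⟨f, by simpa only [hf] using hb⟩

lemma exists_algebraicIndependent_prodField {X Z : ProjVariety N} {a b : ℕ} (ha : X.HasDim a)
    (hb : Z.HasDim b) :
    ∃ w : Fin (a + 1) ⊕ Fin (b + 1) → X.prodField Z, AlgebraicIndependent ℂ w := by
  obtain ⟨f, hf⟩ := ha.exists_algebraicIndependent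
  obtain ⟨g, hg⟩ := hb.exists_algebraicIndependent
  have hfg : AlgebraicIndependent ℂ fun i => Ideal.Quotient.mk (X.prodIdeal Z)
      (Sum.elim (fun i => rename Sum.inl (f i)) (fun i => rename Sum.inr (g i)) i) :=
    algebraicIndependent_sumElim_rename hf hg
  exact ⟨_, hfg.map' (f := IsScalarTower.toAlgHom ℂ _ (X.prodField Z))
    (IsFractionRing.injective _ _)⟩

end

end ProjVariety

section Jacobian

/-- The row indices of a square matrix formed by `k` Jacobian rows, one more row, and `M` further
rows. -/
abbrev FrameRow (k M : ℕ) : Type := (Fin k ⊕ Unit) ⊕ Fin M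

/-- An arbitrary matching of the rows with the coordinates; choosing another one changes the
determinants below by a sign. -/
noncomputable def frameRowEquiv (k M : ℕ) : FrameRow k M ≃ Fin (M + k + 1) :=
  Fintype.equivOfCardEq (by simp; omega)

/-- The determinant of a family of `M + k + 1` rows. -/
noncomputable def rowDet {R : Type*} [CommRing R] {k M : ℕ}
    (v : FrameRow k M → Fin (M + k + 1) → R) : R :=
  Matrix.det (Matrix.of fun a b => v a (frameRowEquiv k M b))

/-- The rows of the Jacobian matrix of `f` at a point `x` with coordinates in an algebra. -/
noncomputable def jacRow {R : Type*} [CommRing R] [Algebra ℂ R] {k N : ℕ} (f : Fin k → HomPoly N)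
    (x : Fin (N + 1) → R) (i : Fin k) (l : Fin (N + 1)) : R :=
  aeval x (pderiv l (f i))

/-- The Jacobian rows of `f` at `x`, completed by the row `u` and the rows `v`. -/
noncomputable def frame {R : Type*} [CommRing R] [Algebra ℂ R] {k M : ℕ}
    (f : Fin k → HomPoly (M + k)) (x u : Fin (M + k + 1) → R) (v : Fin M → Fin (M + k + 1) → R) :
    FrameRow k M → Fin (M + k + 1) → R :=
  Sum.elim (Sum.elim (jacRow f x) fun _ => u) v

/-- The determinant of the Jacobian rows completed by coordinate rows: up to sign, a maximal minor
of the Jacobian matrix (or zero). -/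
noncomputable def jacDet {R : Type*} [CommRing R] [Algebra ℂ R] {k M : ℕ}
    (f : Fin k → HomPoly (M + k)) (x : Fin (M + k + 1) → R) (j : Fin (M + k + 1))
    (l : Fin M → Fin (M + k + 1)) : R :=
  rowDet (frame f x (Pi.single j 1) fun r => Pi.single (l r) 1)

lemma map_jacDet {R S : Type*} [CommRing R] [Algebra ℂ R] [CommRing S] [Algebra ℂ S]
    (φ : R →ₐ[ℂ] S) {k M : ℕ} (f : Fin k → HomPoly (M + k)) (x : Fin (M + k + 1) → R)
    (j : Fin (M + k + 1)) (l : Fin M → Fin (M + k + 1)) :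
    φ (jacDet f x j l) = jacDet f (fun i => φ (x i)) j l := by
  rw [jacDet, rowDet, AlgHom.map_det, jacDet, rowDet]
  congr 1
  ext a b
  rcases a with (i | _) | r
  · simp [frame, jacRow, comp_aeval_apply]
  · simp [frame, Pi.single_apply, apply_ite φ]
  · simp [frame, Pi.single_apply, apply_ite φ]

lemma aeval_jacDet_X {R : Type*} [CommRing R] [Algebra ℂ R] {k M : ℕ}
    (f : Fin k → HomPoly (M + k)) (x : Fin (M + k + 1) → R)
    (j : Fin (M + k + 1)) (l : Fin M → Fin (M + k + 1)) :
    aeval x (jacDet f (X : _ → HomPoly (M + k)) j l) = jacDet f x j l := by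
  simp only [map_jacDet, aeval_X]

lemma isHomogeneous_det {n σ R : Type*} [CommRing R] [Fintype n] [DecidableEq n]
    {A : Matrix n n (MvPolynomial σ R)} {c : n → ℕ} (h : ∀ a b, (A a b).IsHomogeneous (c a)) :
    A.det.IsHomogeneous (∑ a, c a) := by
  rw [← Matrix.det_transpose, Matrix.det_apply']
  refine IsHomogeneous.sum _ _ _ fun π _ => ?_
  have hsign : ((Equiv.Perm.sign π : ℤ) : MvPolynomial σ R).IsHomogeneous 0 := by
    rw [← map_intCast (C : R →+* MvPolynomial σ R)]
    exact isHomogeneous_C _ _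
  simpa only [zero_add, Matrix.transpose_apply] using
    hsign.mul (IsHomogeneous.prod _ _ c fun i _ => h i (π i))

lemma isHomogeneous_jacDet {k M : ℕ} {d : Fin k → ℕ} {f : Fin k → HomPoly (M + k)}
    (hf : ∀ i, (f i).IsHomogeneous (d i)) (hd : ∀ i, 1 ≤ d i) (hsum : ∑ i, d i = M + k)
    (j : Fin (M + k + 1)) (l : Fin M → Fin (M + k + 1)) :
    (jacDet f (X : Fin (M + k + 1) → HomPoly (M + k)) j l).IsHomogeneous M := by
  have hM : ∑ i, (d i - 1) = M := by
    have h := Finset.sum_tsub_distrib (s := Finset.univ) (f := d) (g := fun _ => 1) fun i _ => hd i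
    simp only [hsum, Finset.sum_const, Finset.card_univ, Fintype.card_fin] at h
    simpa using h
  have hsingle : ∀ i b : Fin (M + k + 1),
      ((Pi.single i 1 : Fin (M + k + 1) → HomPoly (M + k)) b).IsHomogeneous 0 := by
    intro i b
    rw [Pi.single_apply]
    split_ifs
    · exact isHomogeneous_one _ _
    · exact isHomogeneous_zero _ _ _
  have hrows : ∀ a b, (frame f (X : _ → HomPoly (M + k)) (Pi.single j 1)
      (fun r => Pi.single (l r) 1) a (frameRowEquiv k M b)).IsHomogeneous
        (Sum.elim (Sum.elim (fun i => d i - 1) fun _ => 0) (fun _ => 0) a) := by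
    rintro ((i | _) | r) b
    · simpa only [frame, Sum.elim_inl, jacRow, aeval_X_left_apply] using (hf i).pderiv
    · exact hsingle _ _
    · exact hsingle _ _
  have h := isHomogeneous_det (A := Matrix.of fun a b => frame f (X : _ → HomPoly (M + k))
    (Pi.single j 1) (fun r => Pi.single (l r) 1) a (frameRowEquiv k M b)) hrows
  simp only [Fintype.sum_sum_type, Sum.elim_inl, Sum.elim_inr, Finset.sum_const_zero, add_zero,
    hM] at h
  exact h

lemma rowDet_ne_zero_iff {K : Type*} [Field K] {k M : ℕ}
    {v : FrameRow k M → Fin (M + k + 1) → K} : rowDet v ≠ 0 ↔ LinearIndependent K v := by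
  rw [rowDet, ← isUnit_iff_ne_zero, ← Matrix.isUnit_iff_isUnit_det,
    ← Matrix.linearIndependent_rows_iff_isUnit]
  exact LinearMap.linearIndependent_iff_of_injOn
    (LinearEquiv.funCongrLeft K K (frameRowEquiv k M)).toLinearMap
    (LinearEquiv.funCongrLeft K K (frameRowEquiv k M)).injective.injOn

lemma exists_linearIndependent_single {K ι : Type*} [Field K] [Fintype ι] {n b : ℕ}
    {v : ι → Fin n → K} (hv : LinearIndependent K v) (hcard : Fintype.card ι + b = n) :
    ∃ l : Fin b → Fin n, LinearIndependent K (Sum.elim v fun r => Pi.single (l r) (1 : K)) := by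
  let U := Submodule.span K (Set.range v)
  obtain ⟨κ, a, -, hspan, hind⟩ := exists_linearIndependent' K
    (fun i : Fin n => U.mkQ (Pi.single i 1))
  have htop : Submodule.span K (Set.range fun i : Fin n => U.mkQ (Pi.single i (1 : K))) = ⊤ := by
    have h : (Set.range fun i : Fin n => U.mkQ (Pi.single i (1 : K))) =
        U.mkQ '' Set.range (Pi.basisFun K (Fin n)) := by
      rw [← Set.range_comp]
      congr 1
      funext i
      simp
    rw [h, Submodule.span_image, (Pi.basisFun K (Fin n)).span_eq, Submodule.map_top,
      Submodule.range_mkQ]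
  have hfin : Finite κ := hind.finite
  let _ := Fintype.ofFinite κ
  have hκ : Fintype.card κ = b := by
    have h := finrank_span_eq_card hind
    rw [hspan, htop, finrank_top, Submodule.finrank_quotient, finrank_span_eq_card hv,
      Module.finrank_fin_fun] at h
    omega
  let e : Fin b ≃ κ := (Fintype.equivFinOfCardEq hκ).symm
  have hsub : LinearIndependent K fun i => (⟨v i, Submodule.subset_span ⟨i, rfl⟩⟩ : U) :=
    LinearIndependent.of_comp U.subtype hv
  exact ⟨a ∘ e, hsub.sumElim_of_quotient _ (hind.comp e e.injective)⟩

lemma sum_jacRow_mul_eq_zero {R : Type*} [CommRing R] [Algebra ℂ R] {k N : ℕ}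
    {f : Fin k → HomPoly N} {d : Fin k → ℕ} (hf : ∀ i, (f i).IsHomogeneous (d i))
    {x : Fin (N + 1) → R} (hx : ∀ i, aeval x (f i) = 0) (i : Fin k) :
    ∑ l, jacRow f x i l * x l = 0 := by
  have h := congrArg (aeval x) (hf i).sum_X_mul_pderiv
  rw [map_sum, map_nsmul, hx, smul_zero] at h
  simpa only [map_mul, aeval_X, jacRow, mul_comm] using h

lemma linearIndependent_jacRow {N k : ℕ} {f : Fin k → HomPoly N} {d : Fin k → ℕ}
    (hf : ∀ i, (f i).IsHomogeneous (d i)) (hsmooth : IsSmoothCI f) {z : Fin (N + 1) → ℂ}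
    (hz : z ≠ 0) (hzf : ∀ i, eval z (f i) = 0) : LinearIndependent ℂ (jacRow f z) := by
  obtain ⟨a, ha⟩ := Projectivization.exists_smul_eq_mk_rep ℂ z hz
  have hmem : Projectivization.mk ℂ z hz ∈ projZeros (Set.range f) := by
    rintro _ ⟨i, rfl⟩
    rw [← ha, Units.smul_def, eval_smul_of_isHomogeneous (hf i), hzf, mul_zero]
  have h := (hsmooth _ hmem).units_smul fun i => (a ^ (d i - 1))⁻¹
  convert h using 1
  funext i l
  rw [Pi.smul_apply', Pi.smul_apply, Units.smul_def, ← ha, Units.smul_def,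
    eval_smul_of_isHomogeneous (hf i).pderiv, jacRow, aeval_eq_eval, smul_eq_mul, ← mul_assoc]
  simp

lemma single_notMem_span_jacRow {N k : ℕ} {f : Fin k → HomPoly N} {d : Fin k → ℕ}
    (hf : ∀ i, (f i).IsHomogeneous (d i)) {z : Fin (N + 1) → ℂ} (hzf : ∀ i, eval z (f i) = 0)
    {j : Fin (N + 1)} (hj : z j ≠ 0) :
    Pi.single j 1 ∉ Submodule.span ℂ (Set.range (jacRow f z)) := by
  -- By Euler's formula the Jacobian rows lie in the kernel of the pairing with `z`.
  have hker : Submodule.span ℂ (Set.range (jacRow f z)) ≤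
      LinearMap.ker ((dotProductBilin ℂ ℂ).flip z) := by
    refine Submodule.span_le.mpr ?_
    rintro _ ⟨i, rfl⟩
    exact sum_jacRow_mul_eq_zero hf (fun i => by rw [aeval_eq_eval]; exact hzf i) i
  intro hmem
  exact hj (by simpa using hker hmem)

lemma exists_jacDet_ne_zero {M k : ℕ} {f : Fin k → HomPoly (M + k)} {d : Fin k → ℕ}
    (hf : ∀ i, (f i).IsHomogeneous (d i)) (hsmooth : IsSmoothCI f) {z : Fin (M + k + 1) → ℂ}
    (hzf : ∀ i, eval z (f i) = 0) {j : Fin (M + k + 1)} (hj : z j ≠ 0) :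
    ∃ l : Fin M → Fin (M + k + 1), jacDet f z j l ≠ 0 := by
  have hz : z ≠ 0 := fun h => hj (by rw [h]; rfl)
  have hrows : LinearIndependent ℂ (Sum.elim (jacRow f z)
      fun _ : Unit => (Pi.single j 1 : Fin (M + k + 1) → ℂ)) := by
    refine (linearIndependent_jacRow hf hsmooth hz hzf).sum_type ?_ ?_
    · rw [linearIndependent_unique_iff]
      simp
    · rw [Set.range_const, Submodule.disjoint_span_singleton' (by simp)]
      exact single_notMem_span_jacRow hf hzf hj
  obtain ⟨l, hl⟩ := exists_linearIndependent_single hrows (b := M) (by simp; omega)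
  exact ⟨l, rowDet_ne_zero_iff.mpr hl⟩

lemma exists_X_pow_mem_span {σ K : Type*} [Field K] [IsAlgClosed K] [Finite σ]
    {G : Set (MvPolynomial σ K)} {j : σ}
    (h : ∀ v : σ → K, (∀ g ∈ G, eval v g = 0) → v j = 0) :
    ∃ r : ℕ, (X j : MvPolynomial σ K) ^ r ∈ Ideal.span G := by
  change X j ∈ (Ideal.span G).radical
  rw [← vanishingIdeal_zeroLocus_eq_radical (K := K), mem_vanishingIdeal_iff]
  intro v hv
  rw [aeval_X]
  refine h v fun g hg => ?_
  rw [← aeval_eq_eval]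
  exact mem_zeroLocus_iff.mp hv g (Ideal.subset_span hg)

-- The Nullstellensatz carries the nonvanishing of some minor from `ℂ`-points to all points.
lemma exists_jacDet_ne_zero_of_field {E : Type*} [Field E] [Algebra ℂ E] {M k : ℕ}
    {f : Fin k → HomPoly (M + k)} {d : Fin k → ℕ}
    (hf : ∀ i, (f i).IsHomogeneous (d i)) (hsmooth : IsSmoothCI f) {z : Fin (M + k + 1) → E}
    (hzf : ∀ i, aeval z (f i) = 0) {j : Fin (M + k + 1)} (hj : z j ≠ 0) :
    ∃ l : Fin M → Fin (M + k + 1), jacDet f z j l ≠ 0 := by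
  by_contra! hcon
  let G : Set (HomPoly (M + k)) := Set.range f ∪ Set.range fun l => jacDet f X j l
  obtain ⟨r, hr⟩ : ∃ r : ℕ, (X j : HomPoly (M + k)) ^ r ∈ Ideal.span G := by
    refine exists_X_pow_mem_span fun v hv => ?_
    by_contra hvj
    obtain ⟨l, hl⟩ := exists_jacDet_ne_zero hf hsmooth (z := v)
      (fun i => hv _ (Or.inl ⟨i, rfl⟩)) hvj
    refine hl ?_
    rw [← aeval_jacDet_X, aeval_eq_eval]
    exact hv _ (Or.inr ⟨l, rfl⟩)
  have hle : Ideal.span G ≤ RingHom.ker (aeval z : HomPoly (M + k) →ₐ[ℂ] E) := by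
    refine Ideal.span_le.mpr ?_
    rintro _ (⟨i, rfl⟩ | ⟨l, rfl⟩)
    · exact hzf i
    · exact (aeval_jacDet_X f z j l).trans (hcon l)
  have h := hle hr
  rw [RingHom.mem_ker, map_pow, aeval_X] at h
  exact hj (eq_zero_of_pow_eq_zero h)

lemma det_mem_subfield {E n : Type*} [Field E] [Fintype n] [DecidableEq n] {L : Subfield E}
    {A : Matrix n n E} (hA : ∀ a b, A a b ∈ L) : A.det ∈ L := by
  rw [Matrix.det_apply]
  exact sum_mem fun π _ => zsmul_mem (prod_mem fun i _ => hA _ _) _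

lemma mem_subfield_of_mulVec_mem {E n : Type*} [Field E] [Fintype n] [DecidableEq n]
    {L : Subfield E} {A : Matrix n n E} (hA : ∀ a b, A a b ∈ L) (hdet : A.det ≠ 0) {p : n → E}
    (hp : ∀ a, A.mulVec p a ∈ L) (b : n) : p b ∈ L := by
  have hcramer : A.det * p b = (A.updateCol b (A.mulVec p)).det := by
    rw [← Matrix.cramer_apply, Matrix.cramer_eq_adjugate_mulVec, Matrix.mulVec_mulVec,
      Matrix.adjugate_mul, Matrix.smul_mulVec, Matrix.one_mulVec, Pi.smul_apply, smul_eq_mul]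
  rw [← mul_div_cancel_left₀ (p b) hdet, hcramer]
  refine div_mem (det_mem_subfield fun a c => ?_) (det_mem_subfield hA)
  rw [Matrix.updateCol_apply]
  split_ifs
  exacts [hp a, hA a c]

lemma mem_of_jacDet_ne_zero {E : Type*} [Field E] [Algebra ℂ E] {M k : ℕ}
    {f : Fin k → HomPoly (M + k)} {z p : Fin (M + k + 1) → E} {j : Fin (M + k + 1)}
    {l : Fin M → Fin (M + k + 1)} (hdet : jacDet f z j l ≠ 0)
    (hp : ∀ i, ∑ c, jacRow f z i c * p c = 0) {L : Subfield E}
    (hL : ∀ i c, jacRow f z i c ∈ L) (hj : p j ∈ L) (hl : ∀ r, p (l r) ∈ L)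
    (c : Fin (M + k + 1)) : p c ∈ L := by
  have hsingle : ∀ i b : Fin (M + k + 1), (Pi.single i 1 : Fin (M + k + 1) → E) b ∈ L := by
    intro i b
    rw [Pi.single_apply]
    split_ifs
    exacts [one_mem _, zero_mem _]
  rw [← (frameRowEquiv k M).apply_symm_apply c]
  refine mem_subfield_of_mulVec_mem (p := fun b => p (frameRowEquiv k M b)) ?_ hdet ?_ _
  · rintro ((i | _) | r) b
    exacts [hL _ _, hsingle _ _, hsingle _ _]
  · intro a
    change ∑ b, frame f z _ _ a (frameRowEquiv k M b) * p (frameRowEquiv k M b) ∈ L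
    rw [(frameRowEquiv k M).sum_comp fun c => frame f z (Pi.single j 1)
      (fun r => Pi.single (l r) 1) a c * p c]
    rcases a with (i | _) | r
    · simp [frame, hp]
    · simpa [frame, Pi.single_apply] using hj
    · simpa [frame, Pi.single_apply] using hl r

end Jacobian

section FiniteOverForms

variable {σ K B ι : Type*} [CommRing K] [CommRing B] [Algebra K B] (φ : MvPolynomial σ K →ₐ[K] B)

lemma map_mem_of_forall_map_monomial_mem {S : Subalgebra K B} {W : Submodule S B}
    {q : MvPolynomial σ K} (h : ∀ m ∈ q.support, φ (monomial m 1) ∈ W) : φ q ∈ W := by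
  rw [q.as_sum, map_sum]
  refine sum_mem fun m hm => ?_
  rw [← mul_one (coeff m q), ← smul_eq_mul, ← smul_monomial, map_smul,
    ← algebraMap_smul S (coeff m q) (φ _)]
  exact Submodule.smul_mem _ _ (h m hm)

variable {L : ι → MvPolynomial σ K} {c : ι → ℕ}

lemma map_homogeneousComponent_mem_of_mem_span_union (hc : ∀ i, 0 < c i)
    (hL : ∀ i, (L i).IsHomogeneous (c i))
    {W : Submodule (Algebra.adjoin K (Set.range fun i => φ (L i))) B} {e : ℕ}
    (hW : ∀ e' < e, ∀ q, q.IsHomogeneous e' → φ q ∈ W) {p : MvPolynomial σ K}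
    (hp : p ∈ Ideal.span ({q | φ q = 0 ∧ ∃ e', q.IsHomogeneous e'} ∪ Set.range L)) :
    φ (homogeneousComponent e p) ∈ W := by
  classical
  let G : ℕ → AddSubgroup B := fun e' => if e' = e then W.toAddSubgroup else ⊤
  have hG : φ (homogeneousComponent e p) ∈ G e := by
    refine map_homogeneousComponent_mem_of_mem_span (φ : MvPolynomial σ K →+ B) G _ ?_ hp e
    rintro g (⟨hg, e', he'⟩ | ⟨i, rfl⟩)
    · refine ⟨e', he', fun e₁ q _ => ?_⟩
      have hzero : φ (q * g) = 0 := by rw [map_mul, hg, mul_zero]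
      exact hzero ▸ zero_mem _
    · refine ⟨c i, hL i, fun e₁ q hq => ?_⟩
      simp only [G]
      split_ifs with h
      · have hsmul : φ (q * L i) =
            (⟨φ (L i), Algebra.subset_adjoin ⟨i, rfl⟩⟩ :
              Algebra.adjoin K (Set.range fun i => φ (L i))) • φ q := by
          rw [map_mul, mul_comm]
          rfl
        exact hsmul ▸ Submodule.smul_mem _ _ (hW e₁ (by have := hc i; omega) q hq)
      · trivial
  simpa [G] using hG

lemma map_mem_span_monomial [Fintype σ] (hc : ∀ i, 0 < c i)
    (hL : ∀ i, (L i).IsHomogeneous (c i)) {r : ℕ}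
    (hr : ∀ j, X j ^ r ∈ Ideal.span ({q | φ q = 0 ∧ ∃ e, q.IsHomogeneous e} ∪ Set.range L))
    (q : MvPolynomial σ K) :
    φ q ∈ Submodule.span (Algebra.adjoin K (Set.range fun i => φ (L i)))
      ((fun m => φ (monomial m 1)) '' {m : σ →₀ ℕ | m.degree ≤ Fintype.card σ * r}) := by
  suffices hmon : ∀ e : ℕ, ∀ m : σ →₀ ℕ, m.degree = e → φ (monomial m 1) ∈
      Submodule.span (Algebra.adjoin K (Set.range fun i => φ (L i)))
        ((fun m => φ (monomial m 1)) '' {m : σ →₀ ℕ | m.degree ≤ Fintype.card σ * r}) from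
    map_mem_of_forall_map_monomial_mem φ fun m _ => hmon _ m rfl
  intro e
  induction e using Nat.strong_induction_on with
  | _ e ih =>
  intro m hm
  by_cases hme : e ≤ Fintype.card σ * r
  · exact Submodule.subset_span ⟨m, hm.trans_le hme, rfl⟩
  · obtain ⟨j, hj⟩ := exists_le_apply_of_lt_degree (m := m) (r := r) (by rw [hm]; omega)
    have hfactor : monomial m (1 : K) = monomial (m - Finsupp.single j r) 1 * X j ^ r := by
      rw [X_pow_eq_monomial, monomial_mul, mul_one, tsub_add_cancel_of_le]
      rwa [Finsupp.single_le_iff]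
    have h := map_homogeneousComponent_mem_of_mem_span_union φ hc hL (e := e)
      (fun e' he' q hq => map_mem_of_forall_map_monomial_mem φ fun m' hm' =>
        ih e' he' m' (hq.degree_eq_sum_deg_support hm').symm)
      (hfactor ▸ Ideal.mul_mem_left _ (monomial (m - Finsupp.single j r) 1) (hr j))
    rwa [homogeneousComponent_of_mem (isHomogeneous_monomial 1 hm), if_pos rfl] at h

lemma finite_adjoin_range_of_X_pow_mem_span [Finite σ] (hφ : Function.Surjective φ)
    (hc : ∀ i, 0 < c i) (hL : ∀ i, (L i).IsHomogeneous (c i)) {r : ℕ}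
    (hr : ∀ j, X j ^ r ∈ Ideal.span ({q | φ q = 0 ∧ ∃ e, q.IsHomogeneous e} ∪ Set.range L)) :
    Module.Finite (Algebra.adjoin K (Set.range fun i => φ (L i))) B := by
  have := Fintype.ofFinite σ
  refine ⟨Submodule.fg_def.mpr ⟨_, (Finsupp.finite_of_degree_le (Fintype.card σ * r)).image
    (fun m => φ (monomial m 1)), ?_⟩⟩
  rw [eq_top_iff]
  rintro b -
  obtain ⟨q, rfl⟩ := hφ b
  exact map_mem_span_monomial φ hc hL hr q

end FiniteOverForms

namespace ProjVariety

variable {N : ℕ}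

lemma mem_affineCone_of_forall (Y : ProjVariety N) {v : Fin (N + 1) → ℂ} (hv : v ≠ 0)
    (h : ∀ q ∈ Y.ideal, ∀ e : ℕ, q.IsHomogeneous e → eval v q = 0) :
    v ∈ affineCone Y.carrier := by
  obtain ⟨T, hT, hY⟩ := Y.isAlgebraicSet
  refine ⟨hv, ?_⟩
  rw [hY]
  intro g hg
  obtain ⟨m, hm⟩ := hT g hg
  have hgY : g ∈ Y.ideal := by
    rw [mem_ideal]
    rintro w ⟨hw, hwY⟩
    rw [hY] at hwY
    exact eval_eq_zero_of_rep hm hw (hwY g hg)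
  obtain ⟨a, ha⟩ := Projectivization.exists_smul_eq_mk_rep ℂ v hv
  rw [← ha, Units.smul_def, eval_smul_of_isHomogeneous hm, h g hgY m hm, mul_zero]

lemma exists_forall_X_pow_mem_span (Y : ProjVariety N) {G : Set (HomPoly N)}
    (hG : ∀ v ∈ affineCone Y.carrier, ∃ g ∈ G, eval v g ≠ 0) :
    ∃ r : ℕ, ∀ j : Fin (N + 1), (X j : HomPoly N) ^ r ∈
      Ideal.span ({q | q ∈ Y.ideal ∧ ∃ e : ℕ, q.IsHomogeneous e} ∪ G) := by
  choose r hr using fun j : Fin (N + 1) => exists_X_pow_mem_span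
    (G := {q | q ∈ Y.ideal ∧ ∃ e : ℕ, q.IsHomogeneous e} ∪ G) (j := j) (fun v hv => by
      by_contra hvj
      have hv0 : v ≠ 0 := fun h => hvj (by rw [h]; rfl)
      obtain ⟨g, hg, hne⟩ := hG v (Y.mem_affineCone_of_forall hv0
        fun q hq e he => hv q (Or.inl ⟨hq, e, he⟩))
      exact hne (hv g (Or.inr hg)))
  exact ⟨∑ j, r j, fun j => Ideal.pow_mem_of_pow_mem _ (hr j)
    (Finset.single_le_sum (fun _ _ => Nat.zero_le _) (Finset.mem_univ j))⟩

-- Without a common zero, the coordinate ring would be finite over `ℂ[L₁, …, L_k]`.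
lemma HasDim.exists_common_zero {Y : ProjVariety N} {k : ℕ} (hY : Y.HasDim k)
    {L : Fin k → HomPoly N} {c : Fin k → ℕ} (hc : ∀ i, 0 < c i)
    (hL : ∀ i, (L i).IsHomogeneous (c i)) :
    ∃ v ∈ affineCone Y.carrier, ∀ i, eval v (L i) = 0 := by
  by_contra! hcon
  obtain ⟨r, hr⟩ := Y.exists_forall_X_pow_mem_span (G := Set.range L) fun v hv => by
    obtain ⟨i, hi⟩ := hcon v hv
    exact ⟨L i, ⟨i, rfl⟩, hi⟩
  let φ : HomPoly N →ₐ[ℂ] Y.coordRing := Ideal.Quotient.mkₐ ℂ Y.ideal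
  have hfin : Module.Finite (Algebra.adjoin ℂ (Set.range fun i => φ (L i))) Y.coordRing :=
    finite_adjoin_range_of_X_pow_mem_span φ Ideal.Quotient.mk_surjective hc hL (r := r) <| by
      simpa only [φ, Ideal.Quotient.mkₐ_eq_mk, Ideal.Quotient.eq_zero_iff_mem] using hr
  have halg : Algebra.IsAlgebraic (Algebra.adjoin ℂ (Set.range fun i => φ (L i))) Y.coordRing :=
    (Algebra.IsIntegral.of_finite _ _).isAlgebraic
  have hle := (Algebra.IsAlgebraic.trdeg_le_cardinalMk ℂ (A := Y.coordRing)
    (Set.range fun i => φ (L i))).trans Cardinal.mk_range_le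
  rw [(ringKrullDim_eq_natCast_iff_trdeg_eq (k := ℂ)).mp hY, Cardinal.mk_fin] at hle
  exact absurd (Nat.cast_le.mp hle) (by omega)

end ProjVariety

section Secants

lemma hasStrictFDerivAt_eval {𝕜 ι : Type*} [NontriviallyNormedField 𝕜] [Fintype ι]
    (q : MvPolynomial ι 𝕜) (v : ι → 𝕜) :
    HasStrictFDerivAt (fun w : ι → 𝕜 => eval w q)
      (∑ l, eval v (pderiv l q) • (ContinuousLinearMap.proj l : (ι → 𝕜) →L[𝕜] 𝕜)) v := by
  classical
  induction q using MvPolynomial.induction_on with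
  | C a =>
    simp only [eval_C]
    exact (hasStrictFDerivAt_const a v).congr_fderiv (by ext; simp)
  | add p q hp hq =>
    simp only [map_add]
    refine (hp.fun_add hq).congr_fderiv (ContinuousLinearMap.ext fun w => ?_)
    simp [add_mul, Finset.sum_add_distrib]
  | mul_X p i hp =>
    have hX : HasStrictFDerivAt (fun w : ι → 𝕜 => w i)
        (ContinuousLinearMap.proj i : (ι → 𝕜) →L[𝕜] 𝕜) v :=
      (ContinuousLinearMap.proj (R := 𝕜) (φ := fun _ : ι => 𝕜) i).hasStrictFDerivAt
    simp only [map_mul, eval_X]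
    refine (hp.fun_mul hX).congr_fderiv (ContinuousLinearMap.ext fun w => ?_)
    simp [pderiv_X, Pi.single_apply, apply_ite (eval v), add_mul, Finset.sum_add_distrib,
      Finset.mul_sum, mul_assoc]

lemma exists_hasDerivAt_of_mem_ker {𝕜 E G : Type*} [NontriviallyNormedField 𝕜] [CompleteSpace 𝕜]
    [NormedAddCommGroup E] [NormedSpace 𝕜 E] [CompleteSpace E] [NormedAddCommGroup G]
    [NormedSpace 𝕜 G] [FiniteDimensional 𝕜 G] {g : E → G} {g' : E →L[𝕜] G} {y : E}
    (hg : HasStrictFDerivAt g g' y) (hrange : g'.range = ⊤) (p : g'.ker) :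
    ∃ γ : 𝕜 → E, γ 0 = y ∧ HasDerivAt γ p 0 ∧ ∀ᶠ t in nhds (0 : 𝕜), g (γ t) = g y := by
  let φ := HasStrictFDerivAt.implicitFunction g g' hg hrange (g y)
  have hline : HasDerivAt (fun t : 𝕜 => t • p) p 0 := by
    simpa using (hasDerivAt_id (0 : 𝕜)).smul_const p
  have hφ : HasFDerivAt φ g'.ker.subtypeL ((0 : 𝕜) • p) := by
    rw [zero_smul]
    exact (hg.to_implicitFunction hrange).hasFDerivAt
  have htendsto : Filter.Tendsto (fun t : 𝕜 => (g y, t • p)) (nhds 0) (nhds (g y, 0)) := by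
    simpa using tendsto_const_nhds.prodMk_nhds hline.continuousAt.tendsto
  have hγ : HasDerivAt (φ ∘ fun t : 𝕜 => t • p) (p : E) 0 := hφ.comp_hasDerivAt (0 : 𝕜) hline
  refine ⟨fun t => φ (t • p), ?_, hγ, htendsto.eventually (hg.map_implicitFunction_eq hrange)⟩
  simp [φ]

lemma mem_affineCone_iff_forall_eval_eq_zero {N k : ℕ} {f : Fin k → HomPoly N} {d : Fin k → ℕ}
    (hf : ∀ i, (f i).IsHomogeneous (d i)) {v : Fin (N + 1) → ℂ} (hv : v ≠ 0) :
    v ∈ affineCone (projZeros (Set.range f)) ↔ ∀ i, eval v (f i) = 0 := by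
  refine ⟨fun h i => eval_eq_zero_of_rep (hf i) hv (h.2 _ ⟨i, rfl⟩), fun h => ⟨hv, ?_⟩⟩
  rintro _ ⟨i, rfl⟩
  obtain ⟨b, hb⟩ := Projectivization.exists_smul_eq_mk_rep ℂ v hv
  rw [← hb, Units.smul_def, eval_smul_of_isHomogeneous (hf i), h i, mul_zero]

lemma exists_curve_mem_affineCone {N k : ℕ} {f : Fin k → HomPoly N} {d : Fin k → ℕ}
    (hf : ∀ i, (f i).IsHomogeneous (d i)) (hsmooth : IsSmoothCI f) {y p : Fin (N + 1) → ℂ}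
    (hy : y ∈ affineCone (projZeros (Set.range f))) (hp : ∀ i, ∑ l, jacRow f y i l * p l = 0) :
    ∃ γ : ℂ → Fin (N + 1) → ℂ, γ 0 = y ∧ HasDerivAt γ p 0 ∧
      ∀ᶠ t in nhds (0 : ℂ), γ t ∈ affineCone (projZeros (Set.range f)) := by
  have hyf := (mem_affineCone_iff_forall_eval_eq_zero hf hy.1).mp hy
  let g' : (Fin (N + 1) → ℂ) →L[ℂ] Fin k → ℂ := ContinuousLinearMap.pi fun i =>
    ∑ l, eval y (pderiv l (f i)) • (ContinuousLinearMap.proj l : (Fin (N + 1) → ℂ) →L[ℂ] ℂ)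
  have hg : HasStrictFDerivAt (fun w i => eval w (f i)) g' y :=
    hasStrictFDerivAt_pi.mpr fun i => hasStrictFDerivAt_eval (f i) y
  have hg' : (g' : (Fin (N + 1) → ℂ) →ₗ[ℂ] Fin k → ℂ) = (Matrix.of (jacRow f y)).mulVecLin := by
    ext w i
    simp [g', jacRow, aeval_eq_eval, Matrix.mulVec, dotProduct]
  have hrange : g'.range = ⊤ := by
    refine Submodule.eq_top_of_finrank_eq ?_
    have hrank : (Matrix.of (jacRow f y)).rank = k := by
      simpa using LinearIndependent.rank_matrix (M := Matrix.of (jacRow f y))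
        (linearIndependent_jacRow hf hsmooth hy.1 hyf)
    rw [Matrix.rank, ← hg'] at hrank
    rw [Module.finrank_fin_fun]
    exact hrank
  have hker : p ∈ g'.ker := LinearMap.mem_ker.mpr <| (congrArg (· p) hg').trans (funext hp)
  obtain ⟨γ, hγ, hderiv, hev⟩ := exists_hasDerivAt_of_mem_ker hg hrange ⟨p, hker⟩
  refine ⟨γ, hγ, hderiv, ?_⟩
  filter_upwards [hev, hderiv.continuousAt.eventually_ne (by rw [hγ]; exact hy.1)] with t ht hne
  exact (mem_affineCone_iff_forall_eval_eq_zero hf hne).mpr fun i => (congrFun ht i).trans (hyf i)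

-- A tangent vector is a limit of multiples of secants, and the two cones are stable under scaling.
lemma eval_eq_zero_of_mem_tangentSpace {N k : ℕ} {f : Fin k → HomPoly N} {d : Fin k → ℕ}
    (hf : ∀ i, (f i).IsHomogeneous (d i)) (hsmooth : IsSmoothCI f) {F Y : ProjVariety N}
    (hF : F.carrier = projZeros (Set.range f)) (hYF : Y.carrier ⊆ F.carrier) {a : HomPoly N}
    (ha : ∀ v ∈ affineCone F.carrier, ∀ w ∈ affineCone Y.carrier, eval (v - w) a = 0)
    {y p : Fin (N + 1) → ℂ} (hy : y ∈ affineCone Y.carrier)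
    (hp : ∀ i, ∑ l, jacRow f y i l * p l = 0) : eval p a = 0 := by
  obtain ⟨γ, hγ, hderiv, hmem⟩ := exists_curve_mem_affineCone hf hsmooth
    (hF ▸ ⟨hy.1, hYF hy.2⟩) hp
  rw [← hF] at hmem
  have hslope := hasDerivAt_iff_tendsto_slope_zero.mp hderiv
  simp only [zero_add, hγ] at hslope
  have hlim : Filter.Tendsto (fun t : ℂ => eval (t⁻¹ • (γ t - y)) a) (nhdsWithin 0 {0}ᶜ)
      (nhds (eval p a)) := ((continuous_eval a).tendsto p).comp hslope
  refine tendsto_nhds_unique_of_eventuallyEq hlim tendsto_const_nhds ?_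
  filter_upwards [hmem.filter_mono nhdsWithin_le_nhds, self_mem_nhdsWithin] with t ht ht0
  rw [smul_sub]
  exact ha _ (smul_mem_affineCone ht (inv_ne_zero ht0)) _
    (smul_mem_affineCone hy (inv_ne_zero ht0))

-- Every `p` is tangent to `F` at some point of `Y`, by counting dimensions on `Y`.
lemma eq_zero_of_forall_eval_sub_eq_zero {N k : ℕ} {f : Fin k → HomPoly N} {d : Fin k → ℕ}
    (hd : ∀ i, 2 ≤ d i) (hf : ∀ i, (f i).IsHomogeneous (d i)) (hsmooth : IsSmoothCI f)
    {F Y : ProjVariety N} (hF : F.carrier = projZeros (Set.range f)) (hYF : Y.carrier ⊆ F.carrier)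
    (hY : Y.HasDim k) {a : HomPoly N}
    (ha : ∀ v ∈ affineCone F.carrier, ∀ w ∈ affineCone Y.carrier, eval (v - w) a = 0) : a = 0 := by
  refine MvPolynomial.funext fun p => ?_
  rw [map_zero]
  obtain ⟨y, hy, hyp⟩ := hY.exists_common_zero
    (L := fun i => ∑ l, pderiv l (f i) * (C (p l) : HomPoly N)) (c := fun i => d i - 1)
    (fun i => Nat.sub_pos_of_lt (hd i))
    (fun i => IsHomogeneous.sum _ _ _ fun l _ => by
      simpa using (hf i).pderiv.mul (isHomogeneous_C (Fin (N + 1)) (p l)))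
  refine eval_eq_zero_of_mem_tangentSpace hf hsmooth hF hYF ha hy (p := p) fun i => ?_
  simpa only [jacRow, aeval_eq_eval, map_sum, map_mul, eval_C] using hyp i

lemma ProjVariety.algebraicIndependent_genFst_sub_genSnd {N k : ℕ} {f : Fin k → HomPoly N}
    {d : Fin k → ℕ} (hd : ∀ i, 2 ≤ d i) (hf : ∀ i, (f i).IsHomogeneous (d i))
    (hsmooth : IsSmoothCI f) {F Y : ProjVariety N} (hF : F.carrier = projZeros (Set.range f))
    (hYF : Y.carrier ⊆ F.carrier) (hY : Y.HasDim k) :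
    AlgebraicIndependent ℂ fun i => F.genFst Y i - F.genSnd Y i := by
  rw [algebraicIndependent_iff]
  intro a ha
  have hdiff : (fun i => F.genFst Y i - F.genSnd Y i) = fun i =>
      aeval (Sum.elim (F.genFst Y) (F.genSnd Y))
        (X (Sum.inl i) - X (Sum.inr i) : MvPolynomial (Fin (N + 1) ⊕ Fin (N + 1)) ℂ) := by
    funext i
    simp
  rw [hdiff, ← comp_aeval_apply, aeval_gen_eq_zero] at ha
  refine eq_zero_of_forall_eval_sub_eq_zero hd hf hsmooth hF hYF hY fun v hv w hw => ?_
  rw [← ha v hv w hw, ← aeval_eq_eval (Sum.elim v w), comp_aeval_apply, aeval_eq_eval]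
  congr 2
  funext i
  simp

end Secants

section AlgebraicRank

variable {K E : Type*} [Field K] [Field E] [Algebra K E]

/-- The subfield of the elements algebraic over `K(S)`. -/
def algClosureSubfield (K : Type*) [Field K] [Algebra K E] (S : Set E) : Subfield E where
  carrier := {x | IsAlgebraic (Algebra.adjoin K S) x}
  mul_mem' := fun ha hb => ha.mul hb
  one_mem' := isAlgebraic_one
  add_mem' := fun ha hb => ha.add hb
  zero_mem' := isAlgebraic_zero
  neg_mem' := fun ha => ha.neg
  inv_mem' := fun _ ha => ha.inv

lemma mem_algClosureSubfield_iff {S : Set E} {x : E} :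
    x ∈ algClosureSubfield K S ↔ x ∈ (AlgebraicIndependent.matroid K E).closure S := by
  rw [AlgebraicIndependent.matroid_closure_eq, SetLike.mem_coe, Subalgebra.mem_algebraicClosure]
  rfl

lemma subset_algClosureSubfield (S : Set E) : S ⊆ algClosureSubfield K S := fun x hx =>
  mem_algClosureSubfield_iff.mpr (Matroid.subset_closure _ _ (by simp) hx)

lemma algebraMap_mem_algClosureSubfield (S : Set E) (c : K) :
    algebraMap K E c ∈ algClosureSubfield K S :=
  isAlgebraic_algebraMap (A := E) (algebraMap K (Algebra.adjoin K S) c)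

lemma aeval_mem_algClosureSubfield {S : Set E} {ι : Type*} {x : ι → E}
    (hx : ∀ i, x i ∈ algClosureSubfield K S) (q : MvPolynomial ι K) :
    aeval x q ∈ algClosureSubfield K S := by
  induction q using MvPolynomial.induction_on with
  | C a => rw [← algebraMap_eq, AlgHom.commutes]; exact algebraMap_mem_algClosureSubfield S a
  | add p q hp hq => rw [map_add]; exact add_mem hp hq
  | mul_X p i hp => rw [map_mul, aeval_X]; exact mul_mem hp (hx i)

lemma card_le_eRk {ι : Type*} [Fintype ι] {w : ι → E} (hw : AlgebraicIndependent K w) {S : Set E}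
    (h : ∀ i, w i ∈ algClosureSubfield K S) :
    (Fintype.card ι : ℕ∞) ≤ (AlgebraicIndependent.matroid K E).eRk S := by
  rw [← Matroid.eRk_closure_eq]
  have hind : (AlgebraicIndependent.matroid K E).Indep (Set.range w) :=
    AlgebraicIndependent.matroid_indep_iff.mpr hw.to_subtype_range
  have hle := hind.encard_le_eRk_of_subset
    (Set.range_subset_iff.mpr fun i => mem_algClosureSubfield_iff.mp (h i))
  rwa [← Set.image_univ, hw.injective.encard_image, Set.encard_univ, ENat.card_eq_coe_fintype_card]
    at hle

lemma eRk_range_le_of_trdeg_le {A : Type*} [CommRing A] [Algebra K A]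
    (φ : A →ₐ[K] E) {n : ℕ} (h : Algebra.trdeg K A ≤ n) :
    (AlgebraicIndependent.matroid K E).eRk (Set.range φ) ≤ n := by
  obtain ⟨T, hT⟩ := (AlgebraicIndependent.matroid K E).exists_isBasis (Set.range φ)
  rw [← hT.encard_eq_eRk]
  have hind : AlgebraicIndependent K ((↑) : T → E) :=
    AlgebraicIndependent.matroid_indep_iff.mp hT.indep
  choose g hg using fun t : T => hT.subset t.2
  have hg' : AlgebraicIndependent K g := by
    refine AlgebraicIndependent.of_comp φ ?_
    have hcomp : φ ∘ g = ((↑) : T → E) := funext hg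
    rwa [hcomp]
  have hle := hg'.lift_cardinalMk_le_trdeg.trans (Cardinal.lift_le.mpr h)
  have hle' := Cardinal.toENat.monotone' hle
  simpa using hle'

open scoped IntermediateField.algebraAdjoinAdjoin in
lemma mem_algClosureSubfield_of_isAlgebraic_adjoin {S : Set E} {z : E}
    (h : IsAlgebraic (IntermediateField.adjoin K S) z) : z ∈ algClosureSubfield K S :=
  (IsFractionRing.isAlgebraic_iff (Algebra.adjoin K S) (IntermediateField.adjoin K S) E).mpr h

end AlgebraicRank

section PolarEquations

lemma aeval_mul_left_of_isHomogeneous {σ K R : Type*} [CommSemiring K] [CommSemiring R]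
    [Algebra K R] {q : MvPolynomial σ K} {e : ℕ} (hq : q.IsHomogeneous e) (t : R) (x : σ → R) :
    aeval (fun i => t * x i) q = t ^ e * aeval x q := by
  rw [aeval_def, aeval_def, eval₂_eq, eval₂_eq, Finset.mul_sum]
  refine Finset.sum_congr rfl fun m hm => ?_
  simp only [mul_pow, Finset.prod_mul_distrib, Finset.prod_pow_eq_pow_sum]
  rw [← hq.degree_eq_sum_deg_support hm, mul_left_comm]

/-- The forms in the coordinates of a point whose coefficients are forms in the coordinates of a
direction. -/
abbrev PolarRing (N : ℕ) : Type := MvPolynomial (Fin (N + 1)) (HomPoly N)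

variable {N : ℕ}

/-- The derivative of `q` in the indeterminate direction. -/
noncomputable def polarForm (q : HomPoly N) : PolarRing N :=
  ∑ l, map C (pderiv l q) * C (X l)

/-- The equations of the points of `Y` where `Q` and the derivatives of the `f i` in the
indeterminate direction vanish. -/
def polarEquations {k : ℕ} (f : Fin k → HomPoly N) (Y : ProjVariety N) (Q : HomPoly N) :
    Set (PolarRing N) :=
  map C '' {q | q ∈ Y.ideal ∧ ∃ e : ℕ, q.IsHomogeneous e} ∪
    insert (map C Q) (Set.range fun i => polarForm (f i))

lemma isHomogeneous_polarForm {e : ℕ} {q : HomPoly N} (hq : q.IsHomogeneous e) :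
    (polarForm q).IsHomogeneous (e - 1) :=
  IsHomogeneous.sum _ _ _ fun l _ => by
    simpa using (hq.pderiv.map C).mul (isHomogeneous_C (Fin (N + 1)) (X l : HomPoly N))

section Specialization

variable {R : Type*} [CommRing R] [Algebra ℂ R] (π : PolarRing N →ₐ[ℂ] R)

lemma algHom_map_C (q : HomPoly N) : π (map C q) = aeval (fun i => π (X i)) q := by
  induction q using MvPolynomial.induction_on with
  | C a => rw [map_C, ← algebraMap_eq (R := ℂ), AlgHom.commutes]; exact π.commutes a
  | add p q hp hq => rw [map_add, map_add, map_add, hp, hq]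
  | mul_X q i hq => rw [map_mul, map_mul, map_mul, hq, map_X, aeval_X]

lemma algHom_polarForm (q : HomPoly N) :
    π (polarForm q) = ∑ l, aeval (fun i => π (X i)) (pderiv l q) * π (C (X l)) := by
  simp only [polarForm, map_sum, map_mul, algHom_map_C]

end Specialization

lemma ProjVariety.aeval_eq_zero_of_mem_ideal {R : Type*} [CommRing R] [Algebra ℂ R]
    {Y : ProjVariety N} {y : Fin (N + 1) → R}
    (h : ∀ q ∈ Y.ideal, ∀ e : ℕ, q.IsHomogeneous e → aeval y q = 0) {q : HomPoly N}
    (hq : q ∈ Y.ideal) : aeval y q = 0 := by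
  rw [← sum_homogeneousComponent q, map_sum]
  exact Finset.sum_eq_zero fun e _ => h _ (Y.homogeneousComponent_mem hq e) e
    (homogeneousComponent_isHomogeneous e q)

lemma ProjVariety.HasDim.eRk_range_aeval_le {Y : ProjVariety N} {r : ℕ} (hY : Y.HasDim r)
    {Q : HomPoly N} (hQ : Q ∉ Y.ideal) {E : Type*} [Field E] [Algebra ℂ E] {y : Fin (N + 1) → E}
    (hy : ∀ q ∈ Y.ideal, aeval y q = 0) (hyQ : aeval y Q = 0) :
    (AlgebraicIndependent.matroid ℂ E).eRk
      (Set.range (aeval y : HomPoly N →ₐ[ℂ] E)) ≤ r := by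
  let φ : HomPoly N →ₐ[ℂ] E := aeval y
  have hlt : Y.ideal < RingHom.ker φ := SetLike.lt_iff_le_and_exists.mpr ⟨hy, Q, hyQ, hQ⟩
  have : (RingHom.ker φ).IsPrime := RingHom.ker_isPrime _
  have htrdeg : Algebra.trdeg ℂ (HomPoly N ⧸ RingHom.ker φ) ≤ r := by
    have h := (trdeg_quotient_lt_of_lt (k := ℂ) hlt).trans_eq
      ((ringKrullDim_eq_natCast_iff_trdeg_eq (k := ℂ)).mp hY)
    exact Order.lt_succ_iff.mp (h.trans_eq (by simp))
  refine (Matroid.eRk_mono _ ?_).trans (eRk_range_le_of_trdeg_le (Ideal.kerLiftAlg φ) htrdeg)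
  rintro _ ⟨q, rfl⟩
  exact ⟨Ideal.Quotient.mk _ q, Ideal.kerLiftAlg_mk φ q⟩

variable {M k : ℕ} {f : Fin k → HomPoly (M + k)} {d : Fin k → ℕ} {Y : ProjVariety (M + k)}
  {Q : HomPoly (M + k)} {δ : ℕ}

-- The points of `Y` with `Q = 0` depend on at most `k` parameters and the directions annihilated
-- by the Jacobian matrix at a given point on `M + 1` parameters.
lemma not_algebraicIndependent_of_sum_jacRow_mul_eq_zero
    (hf : ∀ i, (f i).IsHomogeneous (d i)) (hsmooth : IsSmoothCI f) (hfY : ∀ i, f i ∈ Y.ideal)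
    (hY : Y.HasDim k) (hQ : Q ∉ Y.ideal) {E : Type*} [Field E] [Algebra ℂ E]
    {y p : Fin (M + k + 1) → E} {j : Fin (M + k + 1)} (hyj : y j ≠ 0)
    (hy : ∀ q ∈ Y.ideal, aeval y q = 0) (hyQ : aeval y Q = 0)
    (hyp : ∀ i, ∑ l, jacRow f y i l * p l = 0) :
    ¬ AlgebraicIndependent ℂ (Sum.elim (fun _ : Unit => y j) p) := by
  intro hind
  obtain ⟨l, hl⟩ := exists_jacDet_ne_zero_of_field hf hsmooth (fun i => hy _ (hfY i)) hyj
  let T : Set E := insert (p j) (Set.range fun r => p (l r))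
  let S : Set E := Set.range (aeval y : HomPoly (M + k) →ₐ[ℂ] E) ∪ T
  have hS : ∀ q : HomPoly (M + k), aeval y q ∈ algClosureSubfield ℂ S := fun q =>
    subset_algClosureSubfield S (Or.inl ⟨q, rfl⟩)
  have hp : ∀ c, p c ∈ algClosureSubfield ℂ S := mem_of_jacDet_ne_zero hl hyp
    (fun i c => hS _) (subset_algClosureSubfield S (Or.inr (Or.inl rfl)))
    fun r => subset_algClosureSubfield S (Or.inr (Or.inr ⟨r, rfl⟩))
  have hlower := card_le_eRk hind (S := S) <| by
    rintro (_ | c)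
    · simpa using hS (X j)
    · exact hp c
  have hT : T.encard ≤ M + 1 := by
    refine (Set.encard_insert_le _ _).trans (add_le_add ?_ le_rfl)
    rw [← Set.image_univ]
    exact (Set.encard_image_le _ _).trans (by simp)
  have hupper : (AlgebraicIndependent.matroid ℂ E).eRk S ≤ k + (M + 1) :=
    (Matroid.eRk_union_le_eRk_add_encard _ _ _).trans
      (add_le_add (hY.eRk_range_aeval_le hQ hy hyQ) hT)
  have hcard := hlower.trans hupper
  simp only [Fintype.card_sum, Fintype.card_unit, Fintype.card_fin] at hcard
  norm_cast at hcard
  omega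

-- Scaling the point by an indeterminate makes one of its coordinates transcendental over the
-- direction.
lemma exists_mem_polarEquations_map_ne_zero
    (hf : ∀ i, (f i).IsHomogeneous (d i)) (hsmooth : IsSmoothCI f) (hfY : ∀ i, f i ∈ Y.ideal)
    (hY : Y.HasDim k) (hQδ : Q.IsHomogeneous δ) (hQ : Q ∉ Y.ideal) {E : Type*} [Field E]
    [Algebra ℂ E] (π : PolarRing (M + k) →ₐ[ℂ] E) (hC : ∀ a, π (C a) = 0 → a = 0)
    {j : Fin (M + k + 1)} (hj : π (X j) ≠ 0) : ∃ z ∈ polarEquations f Y Q, π z ≠ 0 := by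
  by_contra! hzero
  let ι : E →ₐ[ℂ] RatFunc E := IsScalarTower.toAlgHom ℂ E (RatFunc E)
  let p : Fin (M + k + 1) → E := fun i => π (C (X i))
  let y : Fin (M + k + 1) → RatFunc E := fun i => RatFunc.X * ι (π (X i))
  have hy : ∀ {q : HomPoly (M + k)} {e : ℕ}, q.IsHomogeneous e →
      aeval y q = RatFunc.X ^ e * ι (π (map C q)) := fun hq => by
    rw [aeval_mul_left_of_isHomogeneous hq, algHom_map_C, comp_aeval_apply]
  have hιj : ι (π (X j)) ≠ 0 := (map_ne_zero ι).mpr hj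
  have hp : AlgebraicIndependent ℂ p :=
    (algebraicIndependent_X (Fin (M + k + 1)) ℂ).map'
      (f := π.comp (IsScalarTower.toAlgHom ℂ (HomPoly (M + k)) (PolarRing (M + k))))
      ((injective_iff_map_eq_zero _).mpr hC)
  have hyj : AlgebraicIndependent E fun _ : Unit => y j := by
    refine algebraicIndependent_unique_type_iff.mpr fun halg => RatFunc.transcendental_X (K := E) ?_
    rw [← mul_inv_cancel_right₀ hιj RatFunc.X]
    exact halg.mul (isAlgebraic_algebraMap (π (X j))).inv
  refine not_algebraicIndependent_of_sum_jacRow_mul_eq_zero hf hsmooth hfY hY hQ (y := y)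
    (mul_ne_zero RatFunc.X_ne_zero hιj)
    (fun _ => ProjVariety.aeval_eq_zero_of_mem_ideal fun q hq e he => ?_) ?_ (fun i => ?_)
    (hp.sumElim_comp hyj)
  · rw [hy he, hzero _ (Or.inl ⟨q, ⟨hq, e, he⟩, rfl⟩), map_zero, mul_zero]
  · rw [hy hQδ, hzero _ (Or.inr (Or.inl rfl)), map_zero, mul_zero]
  · calc ∑ l, jacRow f y i l * ι (p l)
      _ = RatFunc.X ^ (d i - 1) * ι (π (polarForm (f i))) := by
        simp only [polarForm, map_sum, Finset.mul_sum, map_mul, jacRow, hy (hf i).pderiv, mul_assoc,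
          p]
      _ = 0 := by rw [hzero _ (Or.inr (Or.inr ⟨i, rfl⟩)), map_zero, mul_zero]

lemma exists_C_mul_X_pow_mem_span_polarEquations
    (hf : ∀ i, (f i).IsHomogeneous (d i)) (hsmooth : IsSmoothCI f) (hfY : ∀ i, f i ∈ Y.ideal)
    (hY : Y.HasDim k) (hQδ : Q.IsHomogeneous δ) (hQ : Q ∉ Y.ideal) (j : Fin (M + k + 1)) :
    ∃ (a : HomPoly (M + k)) (r : ℕ), a ≠ 0 ∧
      C a * X j ^ r ∈ Ideal.span (polarEquations f Y Q) := by
  by_contra! hcon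
  let S : Submonoid (PolarRing (M + k)) :=
    (nonZeroDivisors (HomPoly (M + k))).map C ⊔ Submonoid.powers (X j)
  have hdisj : Disjoint (Ideal.span (polarEquations f Y Q) : Set (PolarRing (M + k))) S := by
    refine Set.disjoint_left.mpr fun z hz hzS => ?_
    obtain ⟨_, ⟨a, ha, rfl⟩, _, ⟨r, rfl⟩, rfl⟩ := Submonoid.mem_sup.mp hzS
    exact hcon a r (nonZeroDivisors.ne_zero ha) hz
  obtain ⟨P, hP, hle, hPS⟩ := Ideal.exists_le_prime_disjoint _ S hdisj
  obtain ⟨z, hz, hne⟩ := exists_mem_polarEquations_map_ne_zero hf hsmooth hfY hY hQδ hQ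
    (IsScalarTower.toAlgHom ℂ (PolarRing (M + k)) P.ResidueField) (j := j)
    (fun a ha => of_not_not fun ha0 => Set.disjoint_left.mp hPS
      (Ideal.algebraMap_residueField_eq_zero.mp ha)
      (Submonoid.mem_sup_left ⟨a, mem_nonZeroDivisors_of_ne_zero ha0, rfl⟩))
    (fun hj => Set.disjoint_left.mp hPS (Ideal.algebraMap_residueField_eq_zero.mp hj)
      (Submonoid.mem_sup_right (Submonoid.mem_powers _)))
  exact hne (Ideal.algebraMap_residueField_eq_zero.mpr (hle (Ideal.subset_span hz)))

lemma exists_forall_C_mul_X_pow_mem_span_polarEquations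
    (hf : ∀ i, (f i).IsHomogeneous (d i)) (hsmooth : IsSmoothCI f) (hfY : ∀ i, f i ∈ Y.ideal)
    (hY : Y.HasDim k) (hQδ : Q.IsHomogeneous δ) (hQ : Q ∉ Y.ideal) :
    ∃ (a : HomPoly (M + k)) (r : ℕ), a ≠ 0 ∧
      ∀ j, C a * X j ^ r ∈ Ideal.span (polarEquations f Y Q) := by
  choose a r ha hr using exists_C_mul_X_pow_mem_span_polarEquations hf hsmooth hfY hY hQδ hQ
  exact ⟨∏ j, a j, ∑ j, r j, Finset.prod_ne_zero_iff.mpr fun j _ => ha j, fun j =>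
    Ideal.mem_of_dvd _ (mul_dvd_mul (map_dvd C (Finset.dvd_prod_of_mem a (Finset.mem_univ j)))
      (pow_dvd_pow _ (Finset.single_le_sum (fun _ _ => Nat.zero_le _) (Finset.mem_univ j)))) (hr j)⟩

end PolarEquations

section GenericDirection

variable {A Ω : Type*} [Field A] [Field Ω] [Algebra ℂ A] [Algebra ℂ Ω] [Algebra A Ω]
  [IsScalarTower ℂ A Ω]

/-- The specialization of the indeterminate point and direction to `y` and `p`. -/
noncomputable def polarEval {N : ℕ} (y : Fin (N + 1) → Ω) (p : Fin (N + 1) → A) :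
    PolarRing N →ₐ[ℂ] Ω :=
  ((aeval y : MvPolynomial (Fin (N + 1)) A →ₐ[A] Ω).restrictScalars ℂ).comp (mapAlgHom (aeval p))

section

variable {N : ℕ} (y : Fin (N + 1) → Ω) (p : Fin (N + 1) → A)

lemma polarEval_C (q : HomPoly N) : polarEval y p (C q) = algebraMap A Ω (aeval p q) := by
  change aeval y (map (aeval p : HomPoly N →ₐ[ℂ] A).toRingHom (C q)) = _
  rw [map_C, ← algebraMap_eq, AlgHom.commutes]
  rfl

lemma polarEval_X (j : Fin (N + 1)) : polarEval y p (X j) = y j := by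
  simp [polarEval]

lemma polarEval_map_C (q : HomPoly N) : polarEval y p (map C q) = aeval y q := by
  simp only [algHom_map_C, polarEval_X]

lemma polarEval_mem_degreeLE {c : PolarRing N} {e : ℕ} (hc : c.IsHomogeneous e) :
    polarEval y p c ∈ degreeLE A y e :=
  aeval_mem_degreeLE (self_mem_degreeLE y) (hc.map _)

variable {y p} {x : Fin (N + 1) → Ω}

lemma polarEval_polarForm_mem_degreeLE (hx : ∀ i, x i = y i + algebraMap A Ω (p i)) {q : HomPoly N}
    {e : ℕ} (hq : q.IsHomogeneous e) (hxq : aeval x q = 0) (hyq : aeval y q = 0) :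
    polarEval y p (polarForm q) ∈ degreeLE A y (e - 2) := by
  have h := aeval_sub_aeval_sub_sum_pderiv_mem_degreeLE hx hq
  rw [hxq, hyq, sub_zero, zero_sub, neg_mem_iff] at h
  simpa only [algHom_polarForm, polarEval_X, polarEval_C, aeval_X] using h

lemma mul_aeval_mem_map_sup (hx : ∀ i, x i = y i + algebraMap A Ω (p i)) {Q : HomPoly N} {δ : ℕ}
    (hQ : Q.IsHomogeneous δ) {c : Ω} {e : ℤ} (hc : c ∈ degreeLE A y e) :
    c * aeval y Q ∈ (degreeLE A y e).map (LinearMap.mulLeft A (aeval x Q)) ⊔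
      degreeLE A y (e + δ - 1) := by
  have hsplit : c * aeval y Q = aeval x Q * c + -(c * (aeval x Q - aeval y Q)) := by ring
  rw [hsplit]
  exact Submodule.add_mem_sup ⟨c, hc, rfl⟩ (neg_mem
    (mul_mem_degreeLE hc (aeval_sub_aeval_mem_degreeLE hx hQ) (by omega)))

end

variable {M k : ℕ} {f : Fin k → HomPoly (M + k)} {d : Fin k → ℕ} {Y : ProjVariety (M + k)}
  {Q : HomPoly (M + k)} {δ : ℕ} {x y : Fin (M + k + 1) → Ω} {p : Fin (M + k + 1) → A}

-- To leading order, the polar equations hold at `y` in the direction `p = x - y`.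
lemma polarEval_homogeneousComponent_mem_map_sup (hd : ∀ i, 2 ≤ d i)
    (hf : ∀ i, (f i).IsHomogeneous (d i)) (hfY : ∀ i, f i ∈ Y.ideal) (hQδ : Q.IsHomogeneous δ)
    (hx : ∀ i, x i = y i + algebraMap A Ω (p i)) (hxf : ∀ i, aeval x (f i) = 0)
    (hy : ∀ q ∈ Y.ideal, aeval y q = 0) {z : PolarRing (M + k)}
    (hz : z ∈ Ideal.span (polarEquations f Y Q)) (e : ℕ) :
    polarEval y p (homogeneousComponent e z) ∈
      (degreeLE A y (e - δ)).map (LinearMap.mulLeft A (aeval x Q)) ⊔ degreeLE A y (e - 1) := by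
  let W : ℕ → Submodule A Ω := fun e =>
    (degreeLE A y (e - δ)).map (LinearMap.mulLeft A (aeval x Q)) ⊔ degreeLE A y (e - 1)
  refine map_homogeneousComponent_mem_of_mem_span (polarEval y p : PolarRing (M + k) →+ Ω)
    (fun e => (W e).toAddSubgroup) (polarEquations f Y Q) ?_ hz e
  simp only [AddMonoidHom.coe_coe, Submodule.mem_toAddSubgroup, map_mul]
  rintro _ (⟨q, ⟨hq, e', he'⟩, rfl⟩ | rfl | ⟨i, rfl⟩)
  · refine ⟨e', he'.map C, fun e₁ c _ => ?_⟩
    rw [polarEval_map_C, hy q hq, mul_zero]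
    exact zero_mem _
  · refine ⟨δ, hQδ.map C, fun e₁ c hc => ?_⟩
    have h := mul_aeval_mem_map_sup hx hQδ (polarEval_mem_degreeLE y p hc)
    simpa only [polarEval_map_C, W, Nat.cast_add, add_sub_cancel_right] using h
  · refine ⟨d i - 1, isHomogeneous_polarForm (hf i), fun e₁ c hc => ?_⟩
    refine Submodule.mem_sup_right (mul_mem_degreeLE (polarEval_mem_degreeLE y p hc)
      (polarEval_polarForm_mem_degreeLE hx (hf i) (hxf i) (hy _ (hfY i))) ?_)
    have := hd i
    omega

lemma exists_pow_mem_map_sup_degreeLE (hd : ∀ i, 2 ≤ d i)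
    (hf : ∀ i, (f i).IsHomogeneous (d i)) (hsmooth : IsSmoothCI f) (hfY : ∀ i, f i ∈ Y.ideal)
    (hY : Y.HasDim k) (hQδ : Q.IsHomogeneous δ) (hQ : Q ∉ Y.ideal)
    (hx : ∀ i, x i = y i + algebraMap A Ω (p i)) (hp : AlgebraicIndependent ℂ p)
    (hxf : ∀ i, aeval x (f i) = 0) (hy : ∀ q ∈ Y.ideal, aeval y q = 0) :
    ∃ r : ℕ, ∀ j, y j ^ r ∈ (degreeLE A y (r - δ)).map (LinearMap.mulLeft A (aeval x Q)) ⊔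
      degreeLE A y (r - 1) := by
  obtain ⟨a, r, ha, hr⟩ :=
    exists_forall_C_mul_X_pow_mem_span_polarEquations hf hsmooth hfY hY hQδ hQ
  have hpa : aeval p a ≠ 0 := fun h => ha (algebraicIndependent_iff.mp hp a h)
  refine ⟨r, fun j => (Submodule.smul_mem_iff _ hpa).mp ?_⟩
  have hhom : (C a * X j ^ r : PolarRing (M + k)).IsHomogeneous r := by
    simpa using (isHomogeneous_C (Fin (M + k + 1)) a).mul
      ((isHomogeneous_X (HomPoly (M + k)) j).pow r)
  have hmem := polarEval_homogeneousComponent_mem_map_sup hd hf hfY hQδ hx hxf hy (hr j) r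
  rwa [homogeneousComponent_of_mem hhom, if_pos rfl, map_mul, map_pow, polarEval_C, polarEval_X,
    ← Algebra.smul_def] at hmem

-- Modulo the coordinates of `x`, the point `y` is `-p`, and `u` does not vanish at `-p`.
lemma exists_sum_mul_eq_one {ι : Type*} [Fintype ι] {x y : ι → Ω} {p : ι → A}
    (hx : ∀ i, x i = y i + algebraMap A Ω (p i)) (hp : AlgebraicIndependent ℂ p)
    {u : MvPolynomial ι ℂ} {e : ℕ} (hue : u.IsHomogeneous e) (hu : u ≠ 0) (hyu : aeval y u = 0) :
    ∃ c : ι → Ω, (∀ i, c i ∈ Algebra.adjoin A (Set.range y)) ∧ ∑ i, x i * c i = 1 := by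
  let B := Algebra.adjoin A (Set.range y)
  let y' : ι → B := fun i => ⟨y i, Algebra.subset_adjoin ⟨i, rfl⟩⟩
  let x' : ι → B := fun i => y' i + algebraMap A B (p i)
  have hyu' : aeval y' u = 0 :=
    Subtype.ext ((comp_aeval_apply y' (B.val.restrictScalars ℂ) u).trans hyu)
  have hmem : algebraMap A B (aeval (fun i => -1 * p i) u) ∈ Ideal.span (Set.range x') := by
    let π : B →ₐ[ℂ] B ⧸ Ideal.span (Set.range x') := Ideal.Quotient.mkₐ ℂ _
    have hπ : ∀ i, π (algebraMap A B (-1 * p i)) = π (y' i) := fun i => by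
      refine (Ideal.Quotient.eq.mpr ?_).symm
      simpa [x'] using Ideal.subset_span (Set.mem_range_self (f := x') i)
    rw [← Ideal.Quotient.eq_zero_iff_mem, ← aeval_algebraMap_apply]
    refine (comp_aeval_apply _ π u).trans ?_
    simp only [Function.comp_apply, hπ]
    rw [← comp_aeval_apply, hyu', map_zero]
  have hunit : aeval (fun i => -1 * p i) u ≠ 0 := by
    rw [aeval_mul_left_of_isHomogeneous hue]
    exact mul_ne_zero (pow_ne_zero _ (by norm_num)) fun h =>
      hu (algebraicIndependent_iff.mp hp u h)
  have htop := Ideal.eq_top_of_isUnit_mem _ hmem ((isUnit_iff_ne_zero.mpr hunit).map _)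
  rw [Ideal.eq_top_iff_one, Ideal.mem_span_range_iff_exists_fun] at htop
  obtain ⟨c, hc⟩ := htop
  refine ⟨fun i => c i, fun i => (c i).2, ?_⟩
  have hc' := congrArg Subtype.val hc
  rw [AddSubmonoidClass.coe_finsetSum] at hc'
  simpa [x', y', hx, mul_comm] using hc'

end GenericDirection

namespace ProjVariety

section DiffField

variable {N : ℕ}

/-- The field generated by the difference of the generic points of the two cones. -/
noncomputable abbrev diffField (X Z : ProjVariety N) : IntermediateField ℂ (X.prodField Z) :=
  IntermediateField.adjoin ℂ (Set.range fun i => X.genFst Z i - X.genSnd Z i)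

/-- The difference of the generic points of the two cones. -/
noncomputable def genDiff (X Z : ProjVariety N) (i : Fin (N + 1)) : X.diffField Z :=
  ⟨X.genFst Z i - X.genSnd Z i, IntermediateField.subset_adjoin _ _ ⟨i, rfl⟩⟩

lemma genFst_eq (X Z : ProjVariety N) (i : Fin (N + 1)) :
    X.genFst Z i = X.genSnd Z i + algebraMap (X.diffField Z) (X.prodField Z) (X.genDiff Z i) :=
  (add_sub_cancel _ _).symm

lemma mem_algClosureSubfield_of_gen_mem {X Z : ProjVariety N} {S : Set (X.prodField Z)}
    (hx : ∀ i, X.genFst Z i ∈ algClosureSubfield ℂ S)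
    (hy : ∀ i, X.genSnd Z i ∈ algClosureSubfield ℂ S) (w : X.prodField Z) :
    w ∈ algClosureSubfield ℂ S := by
  have hgen : ∀ b : MvPolynomial (Fin (N + 1) ⊕ Fin (N + 1)) ℂ ⧸ X.prodIdeal Z,
      algebraMap _ (X.prodField Z) b ∈ algClosureSubfield ℂ S := fun b => by
    obtain ⟨q, rfl⟩ := Ideal.Quotient.mk_surjective b
    rw [← aeval_gen_eq]
    exact aeval_mem_algClosureSubfield (Sum.rec hx hy) q
  obtain ⟨a, b, -, rfl⟩ := IsFractionRing.div_surjective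
    (A := MvPolynomial (Fin (N + 1) ⊕ Fin (N + 1)) ℂ ⧸ X.prodIdeal Z) w
  exact div_mem (hgen a) (hgen b)

lemma exists_not_isAlgebraic_genSnd {X Z : ProjVariety N} {a b : ℕ} (hX : X.HasDim a)
    (hZ : Z.HasDim b) (hab : N ≤ a + b) :
    ∃ i, ¬ IsAlgebraic (X.diffField Z) (X.genSnd Z i) := by
  by_contra! halg
  let S : Set (X.prodField Z) := Set.range fun i => X.genFst Z i - X.genSnd Z i
  have hy : ∀ i, X.genSnd Z i ∈ algClosureSubfield ℂ S := fun i =>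
    mem_algClosureSubfield_of_isAlgebraic_adjoin (halg i)
  have hx : ∀ i, X.genFst Z i ∈ algClosureSubfield ℂ S := fun i => by
    rw [genFst_eq]
    exact add_mem (hy i) (subset_algClosureSubfield S ⟨i, rfl⟩)
  obtain ⟨w, hw⟩ := exists_algebraicIndependent_prodField hX hZ
  have hlower := card_le_eRk hw fun i => mem_algClosureSubfield_of_gen_mem hx hy (w i)
  have hupper : (AlgebraicIndependent.matroid ℂ (X.prodField Z)).eRk S ≤ (N + 1 : ℕ) := by
    refine (Matroid.eRk_le_encard _ _).trans ?_
    simp only [S]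
    rw [← Set.image_univ]
    exact (Set.encard_image_le _ _).trans (by simp)
  have hcard := Nat.cast_le.mp (hlower.trans hupper)
  simp only [Fintype.card_sum, Fintype.card_fin] at hcard
  omega

end DiffField

lemma mem_ideal_of_carrier_subset {N k : ℕ} {f : Fin k → HomPoly N} {d : Fin k → ℕ}
    (hf : ∀ i, (f i).IsHomogeneous (d i)) {Y : ProjVariety N}
    (hY : Y.carrier ⊆ projZeros (Set.range f)) (i : Fin k) : f i ∈ Y.ideal :=
  mem_ideal.mpr fun _ hv => (mem_affineCone_iff_forall_eval_eq_zero hf hv.1).mp ⟨hv.1, hY hv.2⟩ i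

theorem le_of_mul_mem_degreeLE {M k : ℕ} (hk : 0 < k) {f : Fin k → HomPoly (M + k)} {d : Fin k → ℕ}
    (hd : ∀ i, 2 ≤ d i) (hf : ∀ i, (f i).IsHomogeneous (d i)) (hf0 : ∀ i, f i ≠ 0)
    (hsmooth : IsSmoothCI f) {F Y : ProjVariety (M + k)}
    (hF : F.carrier = projZeros (Set.range f)) (hFdim : F.HasDim M)
    (hYF : Y.carrier ⊆ F.carrier) (hY : Y.HasDim k)
    {g : F.prodField Y} (hg0 : g ≠ 0) {Q : HomPoly (M + k)} {n m s δ : ℕ}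
    (hQδ : Q.IsHomogeneous δ) (hQ : Q ∉ Y.ideal)
    (hQg : aeval (F.genFst Y) Q * g ∈ degreeLE (F.diffField Y) (F.genSnd Y) (δ + n - m))
    (hg : ∀ j, F.genFst Y j ^ s * g ∈ degreeLE (F.diffField Y) (F.genSnd Y) (s + n)) : m ≤ n := by
  by_contra! hnm
  have hp : AlgebraicIndependent ℂ (F.genDiff Y) := .of_comp (F.diffField Y).val
    (algebraicIndependent_genFst_sub_genSnd hd hf hsmooth hF hYF hY)
  have hfF := mem_ideal_of_carrier_subset hf hF.subset
  have hfY := mem_ideal_of_carrier_subset hf (hYF.trans hF.subset)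
  obtain ⟨r, hr⟩ := exists_pow_mem_map_sup_degreeLE hd hf hsmooth hfY hY hQδ hQ (F.genFst_eq Y) hp
    (fun i => aeval_genFst_eq_zero.mpr (hfF i)) fun q hq => aeval_genSnd_eq_zero.mpr hq
  obtain ⟨c, hc, hsum⟩ := exists_sum_mul_eq_one (F.genFst_eq Y) hp (hf ⟨0, hk⟩) (hf0 _)
    (aeval_genSnd_eq_zero.mpr (hfY _))
  obtain ⟨i, hi⟩ := exists_not_isAlgebraic_genSnd hFdim hY le_rfl
  exact hi (isAlgebraic_of_mul_mem_degreeLE_of_lt (F.genFst_eq Y) hg0 hnm hQg hr hg hc hsum i)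

end ProjVariety

section Determinants

section

variable {R V W ι κ : Type*} [CommRing R] [AddCommGroup V] [Module R V] [AddCommGroup W]
  [Module R W]

/-- The alternating map `v ↦ D (u, v)` for a fixed family `u`. -/
def alternatingCompletion (D : V [⋀^ι ⊕ κ]→ₗ[R] W) (u : ι → V) : V [⋀^κ]→ₗ[R] W where
  __ := D.toMultilinearMap.currySum u
  map_eq_zero_of_eq' v r r' h hne :=
    D.map_eq_zero_of_eq _ (i := Sum.inr r) (j := Sum.inr r') h (by simpa using hne)

lemma alternatingCompletion_apply (D : V [⋀^ι ⊕ κ]→ₗ[R] W) (u : ι → V) (v : κ → V) :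
    alternatingCompletion D u v = D (Sum.elim u v) := by
  change D _ = D _
  congr 1

lemma alternatingCompletion_smul_eq [Finite κ] (b : Module.Basis (ι ⊕ κ) R V)
    (D : V [⋀^ι ⊕ κ]→ₗ[R] R) (Ψ : V [⋀^κ]→ₗ[R] W)
    (hΨ : ∀ v r a, v r = b (Sum.inl a) → Ψ v = 0) (v : κ → V) :
    alternatingCompletion D (b ∘ Sum.inl) v • Ψ (b ∘ Sum.inr) = D b • Ψ v := by
  classical
  have := Fintype.ofFinite κ
  set φ := alternatingCompletion D (b ∘ Sum.inl) with hφ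
  have hφb : φ (b ∘ Sum.inr) = D b := by
    rw [hφ, alternatingCompletion_apply, ← Sum.comp_elim, Sum.elim_inl_inr, Function.comp_id]
  suffices hext : (LinearMap.toSpanSingleton R W (Ψ (b ∘ Sum.inr))).compAlternatingMap φ =
      D b • Ψ from congrArg (fun Φ => Φ v) hext
  refine Module.Basis.ext_alternating b fun c hc => ?_
  change φ (fun r => b (c r)) • Ψ (b ∘ Sum.inr) = D b • Ψ fun r => b (c r)
  by_cases h : ∃ r a, c r = Sum.inl a
  · obtain ⟨r, a, ha⟩ := h
    have hφc : φ (fun r => b (c r)) = 0 := by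
      rw [hφ, alternatingCompletion_apply]
      exact D.map_eq_zero_of_eq _ (i := Sum.inl a) (j := Sum.inr r) (congrArg b ha.symm) (by simp)
    rw [hφc, hΨ (fun r => b (c r)) r a (congrArg b ha), zero_smul, smul_zero]
  · have hinr : ∀ r, ∃ t, c r = Sum.inr t := fun r =>
      (Sum.exists.mp ⟨c r, rfl⟩).resolve_left fun ⟨a, ha⟩ => h ⟨r, a, ha⟩
    choose τ hτ using hinr
    have hinj : Function.Injective τ := fun r r' hrr => hc (by rw [hτ, hτ, hrr])
    let σ : Equiv.Perm κ := Equiv.ofBijective τ (Finite.injective_iff_bijective.mp hinj)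
    have hperm : (fun r => b (c r)) = (b ∘ Sum.inr) ∘ σ := funext fun r => congrArg b (hτ r)
    rw [hperm, AlternatingMap.map_perm, AlternatingMap.map_perm, hφb, smul_assoc, smul_comm]

lemma det_mul_eq_det_updateRow_single_mul {n : Type*} [Fintype n] [DecidableEq n]
    {A : Matrix n n R} {z : n → R} {a : n} {c : R} (h : A.mulVec z = Pi.single a c) (j : n) :
    A.det * z j = (A.updateRow a (Pi.single j 1)).det * c := by
  have hadj : A.adjugate.mulVec (A.mulVec z) = A.det • z := by
    rw [Matrix.mulVec_mulVec, Matrix.adjugate_mul, Matrix.smul_mulVec, Matrix.one_mulVec]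
  have hj := congrFun hadj j
  rwa [h, Matrix.mulVec_single, Pi.smul_apply, Pi.smul_apply, Matrix.col_apply,
    Matrix.adjugate_apply, op_smul_eq_mul, smul_eq_mul, eq_comm] at hj

end

variable {K : Type*} [Field K] [Algebra ℂ K] {M k : ℕ}

lemma rowDet_frame_smul_eq {W : Type*} [AddCommGroup W] [Module K W] {f : Fin k → HomPoly (M + k)}
    {z u : Fin (M + k + 1) → K} {w : Fin M → Fin (M + k + 1) → K}
    (hdet : rowDet (frame f z u w) ≠ 0) (Ψ : (Fin (M + k + 1) → K) [⋀^Fin M]→ₗ[K] W)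
    (hJ : ∀ v r i, v r = jacRow f z i → Ψ v = 0) (hu : ∀ v r, v r = u → Ψ v = 0)
    (v : Fin M → Fin (M + k + 1) → K) :
    rowDet (frame f z u v) • Ψ w = rowDet (frame f z u w) • Ψ v := by
  let b := basisOfLinearIndependentOfCardEqFinrank (rowDet_ne_zero_iff.mp hdet) (by simp; omega)
  have hb : ⇑b = frame f z u w := coe_basisOfLinearIndependentOfCardEqFinrank _ _
  let D : (Fin (M + k + 1) → K) [⋀^FrameRow k M]→ₗ[K] K :=
    Matrix.detRowAlternating.compLinearMap (LinearMap.funLeft K K (frameRowEquiv k M))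
  have h := alternatingCompletion_smul_eq b D Ψ (fun v r a ha => ?_) v
  · rw [alternatingCompletion_apply, hb] at h
    exact h
  · rw [hb] at ha
    rcases a with i | _
    · exact hJ v r i ha
    · exact hu v r ha

lemma rowDet_frame_mul {f : Fin k → HomPoly (M + k)} {z u : Fin (M + k + 1) → K}
    {v : Fin M → Fin (M + k + 1) → K} (hJ : ∀ i, ∑ l, jacRow f z i l * z l = 0)
    (hv : ∀ r, ∑ l, v r l * z l = 0) (j : Fin (M + k + 1)) :
    rowDet (frame f z u v) * z j =
      rowDet (frame f z (Pi.single j 1) v) * ∑ l, u l * z l := by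
  let e := frameRowEquiv k M
  let A : Matrix (FrameRow k M) (FrameRow k M) K := Matrix.of fun a b => frame f z u v a (e b)
  have hA : A.mulVec (z ∘ e) = Pi.single (Sum.inl (Sum.inr ())) (∑ l, u l * z l) := by
    funext a
    refine (e.sum_comp fun c => frame f z u v a c * z c).trans ?_
    rcases a with (i | _) | r
    · simpa [frame] using hJ i
    · simp [frame]
    · simpa [frame] using hv r
  have h := det_mul_eq_det_updateRow_single_mul hA (e.symm j)
  rw [Function.comp_apply, e.apply_symm_apply] at h
  refine h.trans (congrArg (fun B => Matrix.det B * _) ?_)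
  ext a b
  rcases a with (i | _) | r
  · simp [A, e, frame, Matrix.updateRow_apply]
  · simp [e, frame, Matrix.updateRow_apply, Pi.single_apply, Equiv.eq_symm_apply]
  · simp [A, e, frame, Matrix.updateRow_apply]

lemma rowDet_frame_smul_sub (f : Fin k → HomPoly (M + k)) (z u : Fin (M + k + 1) → K)
    (w : Fin M → Fin (M + k + 1) → K) (a : K) (b : Fin M → K) :
    rowDet (frame f z u fun r => a • (w r - b r • u)) = a ^ M * rowDet (frame f z u w) := by
  have hsub : rowDet (frame f z u fun r => w r - b r • u) = rowDet (frame f z u w) := by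
    refine Matrix.det_eq_of_forall_row_eq_smul_add_const
      (Sum.elim (fun _ => 0) fun r => - b r) (Sum.inl (Sum.inr ())) rfl fun s t => ?_
    rcases s with (i | _) | r
    · simp [frame]
    · simp [frame]
    · simp only [frame, Matrix.of_apply, Sum.elim_inr, Sum.elim_inl, Pi.sub_apply, Pi.smul_apply,
        smul_eq_mul]
      ring
  rw [← hsub, rowDet, rowDet]
  convert Matrix.det_mul_column (Sum.elim (fun _ => 1) fun _ => a) _ using 2
  · ext s t
    rcases s with (i | _) | r <;> simp [frame]
  · simp

end Determinants

section TopForms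

variable {K : Type*} [Field K] [Algebra ℂ K]

section

variable {σ : Type*} [Fintype σ] (z : σ → K)

/-- The linear map that sends the coordinate vectors to the differentials of the `z l`. -/
noncomputable def coordDiff : (σ → K) →ₗ[K] Ω[K⁄ℂ] :=
  Fintype.linearCombination K fun l => KaehlerDifferential.D ℂ K (z l)

lemma coordDiff_single [DecidableEq σ] (l : σ) :
    coordDiff z (Pi.single l 1) = KaehlerDifferential.D ℂ K (z l) := by
  rw [coordDiff, Fintype.linearCombination_apply_single, one_smul]

lemma coordDiff_aeval_pderiv (q : MvPolynomial σ ℂ) :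
    coordDiff z (fun l => aeval z (pderiv l q)) = KaehlerDifferential.D ℂ K (aeval z q) :=
  (derivation_aeval (KaehlerDifferential.D ℂ K) z q).symm

variable {z}

lemma coordDiff_surjective (hgen : ∀ a : K, ∃ p q : MvPolynomial σ ℂ, a = aeval z p / aeval z q) :
    Function.Surjective (coordDiff z) := by
  rw [← LinearMap.range_eq_top, eq_top_iff, ← KaehlerDifferential.span_range_derivation,
    Submodule.span_le]
  rintro _ ⟨a, rfl⟩
  obtain ⟨p, q, rfl⟩ := hgen a
  rw [Derivation.leibniz_div, ← coordDiff_aeval_pderiv, ← coordDiff_aeval_pderiv]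
  exact Submodule.smul_mem _ _ (sub_mem (Submodule.smul_mem _ _ ⟨_, rfl⟩)
    (Submodule.smul_mem _ _ ⟨_, rfl⟩))

end

/-- The exterior product of the images of `M` vectors under `coordDiff z`. -/
noncomputable def coordForm {σ : Type*} [Fintype σ] (z : σ → K) (M : ℕ) :
    (σ → K) [⋀^Fin M]→ₗ[K] ⋀[K]^M (Ω[K⁄ℂ]) :=
  (exteriorPower.ιMulti K M).compLinearMap (coordDiff z)

lemma coordForm_eq_zero {σ : Type*} [Fintype σ] {z : σ → K} {M : ℕ} {v : Fin M → σ → K} {r : Fin M}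
    (h : coordDiff z (v r) = 0) : coordForm z M v = 0 :=
  (exteriorPower.ιMulti K M).map_coord_zero r h

lemma span_range_coordForm {σ : Type*} [Fintype σ] {z : σ → K} (M : ℕ)
    (hgen : ∀ a : K, ∃ p q : MvPolynomial σ ℂ, a = aeval z p / aeval z q) :
    Submodule.span K (Set.range (coordForm z M)) = ⊤ := by
  rw [eq_top_iff, ← exteriorPower.ιMulti_span]
  refine Submodule.span_mono ?_
  rintro _ ⟨ω, rfl⟩
  choose v hv using fun r => coordDiff_surjective hgen (ω r)
  exact ⟨v, congrArg (exteriorPower.ιMulti K M) (funext hv)⟩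

lemma ιMulti_D_div_eq_coordForm {σ : Type*} [Fintype σ] [DecidableEq σ] (z : σ → K) {M : ℕ} {j : σ}
    (hj : z j ≠ 0) (l : Fin M → σ) :
    exteriorPower.ιMulti K M (fun r => KaehlerDifferential.D ℂ K (z (l r) / z j)) =
      coordForm z M fun r =>
        (z j)⁻¹ • (Pi.single (l r) 1 - (z (l r) / z j) • Pi.single j 1) := by
  refine congrArg (exteriorPower.ιMulti K M) (funext fun r => ?_)
  beta_reduce
  rw [Derivation.leibniz_div, map_smul, map_sub, map_smul, coordDiff_single,
    coordDiff_single, smul_sub, smul_sub, smul_smul, smul_smul, smul_smul]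
  congr 2 <;> field_simp

variable {M k : ℕ} {f : Fin k → HomPoly (M + k)} {d : Fin k → ℕ} {z : Fin (M + k + 1) → K}
  {j₀ : Fin (M + k + 1)}

lemma exists_coordForm_eq_rowDet_smul (hf : ∀ i, (f i).IsHomogeneous (d i)) (hsmooth : IsSmoothCI f)
    (hzf : ∀ i, aeval z (f i) = 0) (hj₀ : z j₀ = 1) :
    ∃ η : ⋀[K]^M (Ω[K⁄ℂ]), ∀ v, coordForm z M v = rowDet (frame f z (Pi.single j₀ 1) v) • η := by
  obtain ⟨l, hl⟩ := exists_jacDet_ne_zero_of_field hf hsmooth hzf (j := j₀)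
    (by rw [hj₀]; exact one_ne_zero)
  have hJ : ∀ i, coordDiff z (jacRow f z i) = 0 := fun i =>
    (coordDiff_aeval_pderiv z (f i)).trans (by rw [hzf, map_zero])
  have hu : coordDiff z (Pi.single j₀ 1) = 0 := by
    rw [coordDiff_single, hj₀, Derivation.map_one_eq_zero]
  refine ⟨(jacDet f z j₀ l)⁻¹ • coordForm z M fun r => Pi.single (l r) 1, fun v => ?_⟩
  rw [smul_comm, rowDet_frame_smul_eq hl (coordForm z M)
    (fun _ _ i h => coordForm_eq_zero (h ▸ hJ i)) (fun _ _ h => coordForm_eq_zero (h ▸ hu))]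
  exact (inv_smul_smul₀ hl _).symm

lemma rowDet_frame_smul_single_sub (hf : ∀ i, (f i).IsHomogeneous (d i))
    (hzf : ∀ i, aeval z (f i) = 0) (hj₀ : z j₀ = 1) {j : Fin (M + k + 1)} (hj : z j ≠ 0)
    (l : Fin M → Fin (M + k + 1)) :
    rowDet (frame f z (Pi.single j₀ 1) fun r =>
      (z j)⁻¹ • (Pi.single (l r) 1 - (z (l r) / z j) • Pi.single j 1)) =
        jacDet f z j l * (z j ^ (M + 1))⁻¹ := by
  have h := rowDet_frame_mul (u := Pi.single j₀ 1)
    (v := fun r => (z j)⁻¹ • (Pi.single (l r) 1 - (z (l r) / z j) • Pi.single j 1))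
    (sum_jacRow_mul_eq_zero hf hzf) (fun r => by
      simp only [Pi.smul_apply, Pi.sub_apply, smul_eq_mul, mul_assoc, sub_mul]
      rw [← Finset.mul_sum, Finset.sum_sub_distrib, ← Finset.mul_sum]
      simp [Pi.single_apply, hj]) j
  have hz : ∑ l, (Pi.single j₀ 1 : Fin (M + k + 1) → K) l * z l = 1 := by
    simp [Pi.single_apply, hj₀]
  rw [rowDet_frame_smul_sub, hz, mul_one] at h
  rw [eq_div_of_mul_eq hj h, jacDet, pow_succ, mul_inv, inv_pow]
  field_simp

-- The form `η` is Griffiths' residue of the complete intersection.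
lemma exists_generator_topForms (hf : ∀ i, (f i).IsHomogeneous (d i)) (hsmooth : IsSmoothCI f)
    (hzf : ∀ i, aeval z (f i) = 0) (hj₀ : z j₀ = 1)
    (hgen : ∀ a : K, ∃ p q : HomPoly (M + k), a = aeval z p / aeval z q) :
    ∃ η : ⋀[K]^M (Ω[K⁄ℂ]), (∀ w, ∃ c : K, w = c • η) ∧
      ∀ (j : Fin (M + k + 1)) (l : Fin M → Fin (M + k + 1)), z j ≠ 0 →
        exteriorPower.ιMulti K M (fun r => KaehlerDifferential.D ℂ K (z (l r) / z j)) =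
          (jacDet f z j l * (z j ^ (M + 1))⁻¹) • η := by
  obtain ⟨η, hη⟩ := exists_coordForm_eq_rowDet_smul hf hsmooth hzf hj₀
  refine ⟨η, fun w => ?_, fun j l hj => ?_⟩
  · have hspan : Submodule.span K (Set.range (coordForm z M)) ≤ Submodule.span K {η} := by
      rw [Submodule.span_le]
      rintro _ ⟨v, rfl⟩
      exact Submodule.mem_span_singleton.mpr ⟨_, (hη v).symm⟩
    rw [span_range_coordForm M hgen] at hspan
    obtain ⟨c, hc⟩ := Submodule.mem_span_singleton.mp (hspan (Submodule.mem_top (x := w)))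
    exact ⟨c, hc.symm⟩
  · rw [ιMulti_D_div_eq_coordForm z hj, hη, rowDet_frame_smul_single_sub hf hzf hj₀ hj]

end TopForms

lemma RatSections.exists_onWedges_eq {K : Type} [Field K] [Algebra ℂ K] {M k : ℕ}
    {f : Fin k → HomPoly (M + k)} {d : Fin k → ℕ} (hf : ∀ i, (f i).IsHomogeneous (d i))
    (hsmooth : IsSmoothCI f) {z : Fin (M + k + 1) → K} (hzf : ∀ i, aeval z (f i) = 0)
    {j₀ : Fin (M + k + 1)} (hj₀ : z j₀ = 1)
    (hgen : ∀ a : K, ∃ p q : HomPoly (M + k), a = aeval z p / aeval z q)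
    {n : ℕ} {s : RatSections K M n} (hs : s ≠ 0) :
    ∃ h : K, h ≠ 0 ∧ ∀ (j : Fin (M + k + 1)) (l : Fin M → Fin (M + k + 1)), z j ≠ 0 →
      s.onWedges (fun _ r => z (l r) / z j) = (jacDet f z j l * (z j ^ (M + 1))⁻¹) ^ n * h := by
  obtain ⟨η, hη, hjl⟩ := exists_generator_topForms hf hsmooth hzf hj₀ hgen
  let t : MultilinearMap K (fun _ : Fin n => ⋀[K]^M (Ω[K⁄ℂ])) K := s
  have hsmul : ∀ c : Fin n → K, t (fun i => c i • η) = (∏ i, c i) * t fun _ => η :=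
    fun c => t.map_smul_univ c fun _ => η
  refine ⟨t fun _ => η, fun h0 => hs ?_, fun j l hj => ?_⟩
  · refine MultilinearMap.ext (f := t) (f' := 0) fun w => ?_
    choose c hc using fun i => hη (w i)
    rw [funext hc, hsmul, h0, mul_zero, zero_apply]
  · change t (fun _ => exteriorPower.ιMulti K M
      fun r => KaehlerDifferential.D ℂ K (z (l r) / z j)) = _
    rw [hjl j l hj, hsmul, Finset.prod_const, Finset.card_univ, Fintype.card_fin]

namespace ProjVariety

variable {N : ℕ}

section Point

lemma ideal_le_ideal {X Z : ProjVariety N} (h : Z.carrier ⊆ X.carrier) : X.ideal ≤ Z.ideal :=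
  fun _ hq => mem_ideal.mpr fun v ⟨hv, hvZ⟩ => mem_ideal.mp hq v ⟨hv, h hvZ⟩

/-- The equation `p_a x_b = p_b x_a` of the point `p`; together these cut out `p`. -/
noncomputable def pointEquation (p : PSpace N) (a : Fin (N + 1) × Fin (N + 1)) : HomPoly N :=
  C (p.rep a.1) * X a.2 - C (p.rep a.2) * X a.1

lemma isHomogeneous_pointEquation (p : PSpace N) (a : Fin (N + 1) × Fin (N + 1)) :
    (pointEquation p a).IsHomogeneous 1 := by
  have h : ∀ (c : ℂ) (i : Fin (N + 1)), (C c * X i : HomPoly N).IsHomogeneous 1 := fun c i => by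
    simpa using (isHomogeneous_C (Fin (N + 1)) c).mul (isHomogeneous_X ℂ i)
  exact (h _ _).sub (h _ _)

lemma projZeros_range_pointEquation (p : PSpace N) :
    projZeros (Set.range (pointEquation p)) = {p} := by
  ext q
  constructor
  · intro hq
    obtain ⟨j, hj⟩ := Function.ne_iff.mp p.rep_nonzero
    rw [Set.mem_singleton_iff, ← q.mk_rep, ← p.mk_rep, Projectivization.mk_eq_mk_iff']
    refine ⟨q.rep j / p.rep j, funext fun i => ?_⟩
    have h := hq _ ⟨(j, i), rfl⟩
    simp only [pointEquation, map_sub, map_mul, eval_C, eval_X] at h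
    rw [Pi.smul_apply, smul_eq_mul, div_mul_eq_mul_div, div_eq_iff hj]
    linear_combination -h
  · rintro rfl _ ⟨a, rfl⟩
    simp only [pointEquation, map_sub, map_mul, eval_C, eval_X]
    ring

/-- A point of projective space, as a variety. -/
def point (p : PSpace N) : ProjVariety N where
  carrier := {p}
  isAlgebraicSet := ⟨Set.range (pointEquation p),
    Set.forall_mem_range.mpr fun a => ⟨1, isHomogeneous_pointEquation p a⟩,
    (projZeros_range_pointEquation p).symm⟩
  nonempty := Set.singleton_nonempty p
  irreducible _ _ _ _ h := by simpa using h

lemma mem_ideal_point_iff {v : Fin (N + 1) → ℂ} (hv : v ≠ 0) {q : HomPoly N} {e : ℕ}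
    (hq : q.IsHomogeneous e) :
    q ∈ (point (Projectivization.mk ℂ v hv)).ideal ↔ eval v q = 0 := by
  refine ⟨fun h => mem_ideal.mp h v ⟨hv, rfl⟩, fun h => mem_ideal.mpr ?_⟩
  rintro w ⟨hw0, hw⟩
  obtain ⟨t, rfl⟩ := (Projectivization.mk_eq_mk_iff' ℂ _ _ hw0 hv).mp hw
  rw [eval_smul_of_isHomogeneous hq, h, mul_zero]

end Point

section FstHom

lemma toConeField_eq_aeval (X : ProjVariety N) (q : HomPoly N) :
    X.toConeField q = aeval (fun l => X.toConeField (MvPolynomial.X l)) q :=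
  DFunLike.congr_fun (aeval_unique ((IsScalarTower.toAlgHom ℂ X.coordRing X.coneField).comp
    (Ideal.Quotient.mkₐ ℂ X.ideal))) q

/-- The embedding of the function field of the first cone into that of the product. -/
noncomputable def fstHom (X Z : ProjVariety N) : X.coneField →+* X.prodField Z :=
  IsFractionRing.lift (A := X.coordRing)
    (g := Ideal.Quotient.lift X.ideal (aeval (X.genFst Z) : HomPoly N →ₐ[ℂ] X.prodField Z).toRingHom
      fun _ hq => aeval_genFst_eq_zero.mpr hq)
    (by
      rw [injective_iff_map_eq_zero]
      intro a ha
      obtain ⟨q, rfl⟩ := Ideal.Quotient.mk_surjective a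
      rw [Ideal.Quotient.lift_mk] at ha
      exact Ideal.Quotient.eq_zero_iff_mem.mpr (aeval_genFst_eq_zero.mp ha))

lemma fstHom_toConeField (X Z : ProjVariety N) (q : HomPoly N) :
    X.fstHom Z (X.toConeField q) = aeval (X.genFst Z) q := by
  rw [toConeField, RingHom.comp_apply, fstHom, IsFractionRing.lift_algebraMap]
  rfl

lemma aeval_genFst_mul_fstHom_div (X Z : ProjVariety N) {a b : HomPoly N} (hb : b ∉ X.ideal) :
    aeval (X.genFst Z) b * X.fstHom Z (X.toConeField a / X.toConeField b) =
      aeval (X.genFst Z) a := by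
  rw [← fstHom_toConeField, ← map_mul, mul_div_cancel₀ _ fun h => hb (toConeField_eq_zero.mp h),
    fstHom_toConeField]

lemma aeval_genFst_mem_degreeLE (X Z : ProjVariety N) {q : HomPoly N} {e : ℕ}
    (hq : q.IsHomogeneous e) :
    aeval (X.genFst Z) q ∈ degreeLE (X.diffField Z) (X.genSnd Z) e :=
  aeval_mem_degreeLE (mem_degreeLE_one_of_eq_add (X.genFst_eq Z)) hq

end FstHom

section DegreeAlong

/-- The rational function `w` on the cone over `X` has degree at most `e` locally along `Z`: up to
a form `b` not vanishing on `Z`, it lies in the corresponding step of the filtration by the degree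
in the generic point of the cone over `W`. -/
def HasDegreeLEAlong (X Z W : ProjVariety N) (w : X.coneField) (e : ℤ) : Prop :=
  ∃ (δ : ℕ) (b : HomPoly N), b.IsHomogeneous δ ∧ b ∉ Z.ideal ∧
    aeval (X.genFst W) b * X.fstHom W w ∈ degreeLE (X.diffField W) (X.genSnd W) (δ + e)

variable {X Z W : ProjVariety N} {w w' : X.coneField} {e e' : ℤ}

lemma HasDegreeLEAlong.add (h : X.HasDegreeLEAlong Z W w e) (h' : X.HasDegreeLEAlong Z W w' e) :
    X.HasDegreeLEAlong Z W (w + w') e := by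
  obtain ⟨δ, b, hb, hbZ, h⟩ := h
  obtain ⟨δ', b', hb', hbZ', h'⟩ := h'
  refine ⟨δ + δ', b * b', hb.mul hb', Z.isPrime_ideal.mul_notMem hbZ hbZ', ?_⟩
  have hsplit : aeval (X.genFst W) (b * b') * X.fstHom W (w + w') =
      aeval (X.genFst W) b' * (aeval (X.genFst W) b * X.fstHom W w) +
        aeval (X.genFst W) b * (aeval (X.genFst W) b' * X.fstHom W w') := by
    rw [RingHom.map_add, map_mul]
    ring
  rw [hsplit]
  exact add_mem (mul_mem_degreeLE (X.aeval_genFst_mem_degreeLE W hb') h (by omega))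
    (mul_mem_degreeLE (X.aeval_genFst_mem_degreeLE W hb) h' (by omega))

lemma HasDegreeLEAlong.mul (h : X.HasDegreeLEAlong Z W w e) (h' : X.HasDegreeLEAlong Z W w' e') :
    X.HasDegreeLEAlong Z W (w * w') (e + e') := by
  obtain ⟨δ, b, hb, hbZ, h⟩ := h
  obtain ⟨δ', b', hb', hbZ', h'⟩ := h'
  refine ⟨δ + δ', b * b', hb.mul hb', Z.isPrime_ideal.mul_notMem hbZ hbZ', ?_⟩
  rw [map_mul, map_mul, mul_mul_mul_comm]
  exact mul_mem_degreeLE h h' (by omega)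

lemma HasDegreeLEAlong.of_toConeField_mul_eq {a c : HomPoly N} {α γ : ℕ} (ha : a.IsHomogeneous α)
    (haZ : a ∉ Z.ideal) (hc : c.IsHomogeneous γ)
    (hac : X.toConeField a * w = X.toConeField c * w') (h : X.HasDegreeLEAlong Z W w' e) :
    X.HasDegreeLEAlong Z W w (γ - α + e) := by
  obtain ⟨δ, b, hb, hbZ, h⟩ := h
  refine ⟨δ + α, b * a, hb.mul ha, Z.isPrime_ideal.mul_notMem hbZ haZ, ?_⟩
  have hac' := congrArg (X.fstHom W) hac
  simp only [map_mul, fstHom_toConeField] at hac'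
  rw [map_mul, mul_assoc, hac', mul_left_comm]
  exact mul_mem_degreeLE (X.aeval_genFst_mem_degreeLE W hc) h (by omega)

lemma hasDegreeLEAlong_of_localRing (W : ProjVariety N) (q : X.localRing Z) :
    X.HasDegreeLEAlong Z W (q : X.functionField) 0 := by
  obtain ⟨m, a, b, ha, hb, hbX, hbZ, hq : ((q : X.functionField) : X.coneField) = _⟩ := q.2
  refine ⟨m, b, hb, hbZ, ?_⟩
  rw [hq, X.aeval_genFst_mul_fstHom_div W hbX, add_zero]
  exact X.aeval_genFst_mem_degreeLE W ha

lemma hasDegreeLEAlong_neg_one_of_mem_ideal {a b : HomPoly N} {m : ℕ} (ha : a.IsHomogeneous m)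
    (hb : b.IsHomogeneous m) (haZ : a ∈ Z.ideal) (hbX : b ∉ X.ideal) (hbZ : b ∉ Z.ideal) :
    X.HasDegreeLEAlong Z Z (X.toConeField a / X.toConeField b) (-1) := by
  refine ⟨m, b, hb, hbZ, ?_⟩
  have h := aeval_sub_aeval_mem_degreeLE (X.genFst_eq Z) ha
  rwa [aeval_genSnd_eq_zero.mpr haZ, sub_zero, ← X.aeval_genFst_mul_fstHom_div Z hbX] at h

variable (X Z) in
/-- The elements of the local ring along `Z` that have degree at most `-m` locally along `Z`, with
respect to the generic point of the cone over `Z` itself. -/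
def degreeIdeal (m : ℕ) : Ideal (X.localRing Z) where
  carrier := {q | X.HasDegreeLEAlong Z Z (q : X.functionField) (-m)}
  zero_mem' := ⟨0, 1, isHomogeneous_one _ _, Z.isPrime_ideal.one_notMem, by simp⟩
  add_mem' := HasDegreeLEAlong.add
  smul_mem' r q hq := zero_add (-m : ℤ) ▸ (hasDegreeLEAlong_of_localRing Z r).mul hq

variable (X Z) in
lemma maxIdealAlong_pow_le_degreeIdeal (m : ℕ) : X.maxIdealAlong Z ^ m ≤ X.degreeIdeal Z m := by
  induction m with
  | zero =>
    rintro q -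
    change X.HasDegreeLEAlong Z Z (q : X.functionField) (-(0 : ℕ))
    simpa using hasDegreeLEAlong_of_localRing Z q
  | succ m ih =>
    have hone : X.maxIdealAlong Z ≤ X.degreeIdeal Z 1 := by
      refine Ideal.span_le.mpr ?_
      rintro q ⟨_, a, b, ha, hb, haZ, hbX, hbZ, hq⟩
      change X.HasDegreeLEAlong Z Z (q : X.functionField) (-1)
      rw [hq]
      exact hasDegreeLEAlong_neg_one_of_mem_ideal ha hb haZ hbX hbZ
    rw [pow_succ, Ideal.mul_le]
    intro q hq q' hq'
    have h := (ih hq).mul (hone hq')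
    rwa [← neg_add, ← Nat.cast_add] at h

-- A function of degree at most `e` at every point of `X` has it globally, up to powers of the
-- coordinates, because the denominators have no common zero.
lemma exists_pow_mul_mem_degreeLE
    (h : ∀ p ∈ X.carrier, X.HasDegreeLEAlong (point p) W w e) :
    ∃ r : ℕ, ∀ j, X.genFst W j ^ r * X.fstHom W w ∈
      degreeLE (X.diffField W) (X.genSnd W) (r + e) := by
  obtain ⟨r, hr⟩ := X.exists_forall_X_pow_mem_span
    (G := {b | ∃ δ : ℕ, b.IsHomogeneous δ ∧ aeval (X.genFst W) b * X.fstHom W w ∈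
      degreeLE (X.diffField W) (X.genSnd W) (δ + e)}) (by
    rintro v ⟨hv0, hv⟩
    obtain ⟨δ, b, hb, hbv, hbw⟩ := h _ hv
    exact ⟨b, ⟨δ, hb, hbw⟩, fun hb0 => hbv ((mem_ideal_point_iff hv0 hb).mpr hb0)⟩)
  let φ : HomPoly N →+ X.prodField W := (AddMonoidHom.mulRight (X.fstHom W w)).comp
    (aeval (X.genFst W) : HomPoly N →ₐ[ℂ] X.prodField W)
  have hφ : ∀ q, φ q = aeval (X.genFst W) q * X.fstHom W w := fun _ => rfl
  refine ⟨r, fun j => ?_⟩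
  have key := map_homogeneousComponent_mem_of_mem_span φ
    (fun δ => (degreeLE (X.diffField W) (X.genSnd W) (δ + e)).toAddSubgroup) _ ?_ (hr j) r
  · rwa [homogeneousComponent_of_mem (by simpa using (isHomogeneous_X ℂ j).pow r), if_pos rfl, hφ,
      map_pow, aeval_X] at key
  simp only [hφ, map_mul, Submodule.mem_toAddSubgroup]
  rintro q (⟨hq, δ, hδ⟩ | ⟨δ, hδ, hqw⟩) <;> refine ⟨δ, hδ, fun δ₁ c hc => ?_⟩
  · rw [aeval_genFst_eq_zero.mpr hq, mul_zero, zero_mul]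
    exact zero_mem _
  · rw [mul_assoc]
    exact mul_mem_degreeLE (X.aeval_genFst_mem_degreeLE W hc) hqw (by omega)

end DegreeAlong

section FormOfSection

/-- The affine coordinates in the chart `{x_j ≠ 0}`, as rational functions. -/
noncomputable def chartCoord (X : ProjVariety N) {j : Fin (N + 1)} (hj : MvPolynomial.X j ∉ X.ideal)
    (l : Fin (N + 1)) : X.functionField :=
  ⟨X.toConeField (MvPolynomial.X l) / X.toConeField (MvPolynomial.X j),
    1, MvPolynomial.X l, MvPolynomial.X j, isHomogeneous_X _ _, isHomogeneous_X _ _, hj, hj, rfl⟩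

lemma exists_X_notMem_ideal (X : ProjVariety N) : ∃ j, MvPolynomial.X j ∉ X.ideal := by
  obtain ⟨v, hv⟩ := X.affineCone_nonempty
  obtain ⟨j, hj⟩ := Function.ne_iff.mp hv.1
  exact ⟨j, fun h => hj (by simpa using mem_ideal.mp h v hv)⟩

variable {X : ProjVariety N} {j₀ : Fin (N + 1)}

lemma toConeField_X_ne_zero (hj₀ : MvPolynomial.X j₀ ∉ X.ideal) :
    X.toConeField (MvPolynomial.X j₀) ≠ 0 :=
  fun h => hj₀ (toConeField_eq_zero.mp h)

variable (hj₀ : MvPolynomial.X j₀ ∉ X.ideal)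

lemma coe_aeval_chartCoord {q : HomPoly N} {e : ℕ} (hq : q.IsHomogeneous e) :
    ((aeval (X.chartCoord hj₀) q : X.functionField) : X.coneField) =
      X.toConeField q / X.toConeField (MvPolynomial.X j₀) ^ e := by
  refine (comp_aeval_apply (R := ℂ) (X.chartCoord hj₀) X.functionField.val q).trans ?_
  have hcoord : (fun l => X.functionField.val (X.chartCoord hj₀ l)) = fun l =>
      (X.toConeField (MvPolynomial.X j₀))⁻¹ * X.toConeField (MvPolynomial.X l) :=
    funext fun l => div_eq_inv_mul _ _
  rw [hcoord, aeval_mul_left_of_isHomogeneous hq, ← toConeField_eq_aeval, inv_pow, div_eq_inv_mul]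

lemma aeval_chartCoord_eq_zero {q : HomPoly N} {e : ℕ} (hq : q.IsHomogeneous e)
    (hqX : q ∈ X.ideal) : aeval (X.chartCoord hj₀) q = 0 := by
  refine Subtype.ext ((coe_aeval_chartCoord hj₀ hq).trans ?_)
  rw [toConeField_eq_zero.mpr hqX, zero_div]
  rfl

lemma chartCoord_self : X.chartCoord hj₀ j₀ = 1 :=
  Subtype.ext (div_self (toConeField_X_ne_zero hj₀))

lemma chartCoord_ne_zero {j : Fin (N + 1)} (hj : MvPolynomial.X j ∉ X.ideal) :
    X.chartCoord hj₀ j ≠ 0 := fun h =>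
  div_ne_zero (toConeField_X_ne_zero hj) (toConeField_X_ne_zero hj₀) (congrArg Subtype.val h)

lemma chartCoord_div_chartCoord {j : Fin (N + 1)} (hj : MvPolynomial.X j ∉ X.ideal)
    (l : Fin (N + 1)) : X.chartCoord hj₀ l / X.chartCoord hj₀ j = X.chartCoord hj l :=
  Subtype.ext (div_div_div_cancel_right₀ (toConeField_X_ne_zero hj₀) _ _)

lemma exists_eq_aeval_chartCoord_div (a : X.functionField) :
    ∃ p q : HomPoly N, a = aeval (X.chartCoord hj₀) p / aeval (X.chartCoord hj₀) q := by
  obtain ⟨m, p, q, hp, hq, -, -, ha : (a : X.coneField) = _⟩ := a.2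
  refine ⟨p, q, Subtype.ext ?_⟩
  rw [ha, IntermediateField.coe_div, coe_aeval_chartCoord hj₀ hp, coe_aeval_chartCoord hj₀ hq,
    div_div_div_cancel_right₀ (pow_ne_zero m (toConeField_X_ne_zero hj₀))]

variable {M k : ℕ} {d : Fin k → ℕ} {f : Fin k → HomPoly (M + k)} {F : ProjVariety (M + k)} {n : ℕ}
  {s : F.RatAnticanonical M n}

-- Index one makes the Jacobian determinants forms of degree `M`, so that `g` has degree `n`.
lemma exists_jacDet_pow_mul_eq (hd : ∀ i, 1 ≤ d i) (hsum : ∑ i, d i = M + k)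
    (hf : ∀ i, (f i).IsHomogeneous (d i)) (hsmooth : IsSmoothCI f) (hfF : ∀ i, f i ∈ F.ideal)
    (hs : s ≠ 0) :
    ∃ g : F.coneField, g ≠ 0 ∧ ∀ (j : Fin (M + k + 1)) (hj : MvPolynomial.X j ∉ F.ideal)
      (l : Fin M → Fin (M + k + 1)),
      F.toConeField (jacDet f MvPolynomial.X j l ^ n) * g =
        F.toConeField (MvPolynomial.X j ^ ((M + 1) * n)) *
          (s.onWedges fun _ r => F.chartCoord hj (l r) : F.functionField) := by
  obtain ⟨j₀, hj₀⟩ := F.exists_X_notMem_ideal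
  obtain ⟨h, hh0, hh⟩ := RatSections.exists_onWedges_eq hf hsmooth
    (fun i => aeval_chartCoord_eq_zero hj₀ (hf i) (hfF i)) (chartCoord_self hj₀)
    (exists_eq_aeval_chartCoord_div hj₀) hs
  have hx₀ := toConeField_X_ne_zero hj₀
  refine ⟨F.toConeField (MvPolynomial.X j₀) ^ n * h,
    mul_ne_zero (pow_ne_zero _ hx₀) fun h0 => hh0 (Subtype.ext h0), fun j hj l => ?_⟩
  have hx := toConeField_X_ne_zero hj
  have hjl := hh j l (chartCoord_ne_zero hj₀ hj)
  simp only [chartCoord_div_chartCoord hj₀ hj] at hjl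
  have hcoord : ((F.chartCoord hj₀ j : F.functionField) : F.coneField) =
    F.toConeField (MvPolynomial.X j) / F.toConeField (MvPolynomial.X j₀) := rfl
  rw [hjl, ← aeval_jacDet_X f (F.chartCoord hj₀)]
  push_cast
  rw [coe_aeval_chartCoord hj₀ (isHomogeneous_jacDet hf hd hsum j l), hcoord, map_pow, map_pow,
    pow_mul, ← mul_assoc, ← mul_assoc, ← mul_pow, ← mul_pow]
  congr 2
  rw [div_pow, inv_div, pow_succ (F.toConeField (MvPolynomial.X j₀))]
  field_simp

lemma exists_jacDet_notMem_ideal (hf : ∀ i, (f i).IsHomogeneous (d i)) (hsmooth : IsSmoothCI f)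
    {Z : ProjVariety (M + k)} (hfZ : ∀ i, f i ∈ Z.ideal) :
    ∃ j l, MvPolynomial.X j ∉ Z.ideal ∧ jacDet f MvPolynomial.X j l ∉ Z.ideal := by
  obtain ⟨v, hv⟩ := Z.affineCone_nonempty
  obtain ⟨j, hj⟩ := Function.ne_iff.mp hv.1
  obtain ⟨l, hl⟩ := exists_jacDet_ne_zero hf hsmooth (fun i => mem_ideal.mp (hfZ i) v hv) hj
  refine ⟨j, l, fun h => hj (by simpa using mem_ideal.mp h v hv), fun h => hl ?_⟩
  rw [← aeval_jacDet_X, aeval_eq_eval]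
  exact mem_ideal.mp h v hv

lemma exists_form_of_section (hd : ∀ i, 1 ≤ d i) (hsum : ∑ i, d i = M + k)
    (hf : ∀ i, (f i).IsHomogeneous (d i)) (hsmooth : IsSmoothCI f) (hfF : ∀ i, f i ∈ F.ideal)
    (hs : s ≠ 0) :
    ∃ g : F.coneField, g ≠ 0 ∧ ∀ (Z W : ProjVariety (M + k)) (m : ℕ) (e : ℤ),
      Z.carrier ⊆ F.carrier → F.VanishesToOrder Z s m →
      (∀ q ∈ F.maxIdealAlong Z ^ m, F.HasDegreeLEAlong Z W (q : F.functionField) e) →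
      F.HasDegreeLEAlong Z W g (n + e) := by
  obtain ⟨g, hg0, hg⟩ := exists_jacDet_pow_mul_eq hd hsum hf hsmooth hfF hs
  refine ⟨g, hg0, fun Z W m e hZF hvan hdeg => ?_⟩
  have hZ : F.ideal ≤ Z.ideal := ideal_le_ideal hZF
  obtain ⟨j, l, hj, hl⟩ := exists_jacDet_notMem_ideal hf hsmooth fun i => hZ (hfF i)
  have hjF : MvPolynomial.X j ∉ F.ideal := fun h => hj (hZ h)
  obtain ⟨q, hqm, hqs⟩ := hvan fun _ r => ⟨F.chartCoord hjF (l r), 1, MvPolynomial.X (l r),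
    MvPolynomial.X j, isHomogeneous_X _ _, isHomogeneous_X _ _, hjF, hj, rfl⟩
  have hgq := hg j hjF l
  rw [← hqs] at hgq
  have h := (hdeg q hqm).of_toConeField_mul_eq ((isHomogeneous_jacDet hf hd hsum j l).pow n)
    (fun h => hl (Z.isPrime_ideal.mem_of_pow_mem n h))
    ((isHomogeneous_X ℂ j).pow ((M + 1) * n)) hgq
  convert h using 1
  push_cast
  ring

end FormOfSection

end ProjVariety

theorem IsFanoCompleteIntersection.le_of_vanishesToOrder {k M : ℕ} (hk : 0 < k) {d : Fin k → ℕ}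
    {f : Fin k → HomPoly (M + k)} {F : ProjVariety (M + k)}
    (hF : IsFanoCompleteIntersection k M d f F) (hsmooth : IsSmoothCI f) {n m : ℕ}
    {s : F.RatAnticanonical M n} (hs : s ≠ 0) (hreg : s ∈ F.anticanonicalSections M n)
    {Y : ProjVariety (M + k)} (hYF : Y.carrier ⊆ F.carrier) (hY : Y.HasDim k)
    (hm : F.VanishesToOrder Y s m) : m ≤ n := by
  obtain ⟨g, hg0, hg⟩ := ProjVariety.exists_form_of_section
    (fun i => one_le_two.trans (hF.two_le_degree i)) hF.sum_degree hF.isHomogeneous hsmooth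
    (ProjVariety.mem_ideal_of_carrier_subset hF.isHomogeneous hF.carrier_eq.subset) hs
  have hpoint : ∀ p ∈ F.carrier, F.HasDegreeLEAlong (.point p) Y g n := fun p hp => by
    have hpF : (ProjVariety.point p).carrier ⊆ F.carrier := Set.singleton_subset_iff.mpr hp
    simpa using hg (.point p) Y 0 0 hpF (hreg _ hpF) fun q _ =>
      ProjVariety.hasDegreeLEAlong_of_localRing Y q
  obtain ⟨r, hr⟩ := ProjVariety.exists_pow_mul_mem_degreeLE hpoint
  obtain ⟨δ, Q, hQδ, hQY, hQg⟩ := hg Y Y m (-m) hYF hm fun q hq =>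
    F.maxIdealAlong_pow_le_degreeIdeal Y m hq
  exact ProjVariety.le_of_mul_mem_degreeLE hk hF.two_le_degree hF.isHomogeneous hF.ne_zero hsmooth
    hF.carrier_eq hF.hasDim hYF hY ((map_ne_zero _).mpr hg0) hQδ hQY
    (by rwa [add_sub_assoc, sub_eq_add_neg]) hr

theorem lemma2p1_general {k M : ℕ} (hk : 0 < k) {d : Fin k → ℕ} {f : Fin k → HomPoly (M + k)}
    {F : ProjVariety (M + k)} (hF : IsFanoCompleteIntersection k M d f F) (hsmooth : IsSmoothCI f)
    {n : ℕ} {S : Submodule ℂ (F.RatAnticanonical M n)} (hS : S ≤ F.anticanonicalSections M n)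
    (hS₀ : S ≠ ⊥) {Y : ProjVariety (M + k)} (hYF : Y.carrier ⊆ F.carrier) (hY : Y.HasDim k) :
    F.multSystem Y S ≤ (n : ℕ∞) := by
  obtain ⟨s, hs, hs0⟩ := Submodule.exists_mem_ne_zero_of_ne_bot hS₀
  refine (iInf₂_le s hs).trans (iSup₂_le fun m hm => ?_)
  exact_mod_cast hF.le_of_vanishesToOrder hk hsmooth hs0 (hS hs) hYF hY hm

theorem lemma2p1 (k M : ℕ) (hk : 2 ≤ k) (hM : 2 * k + 1 ≤ M)
    (d : Fin k → ℕ) (f : Fin k → HomPoly (M + k)) (F : ProjVariety (M + k))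
    (hF : IsFanoCompleteIntersection k M d f F)
    (hsmooth : IsSmoothCI f)
    (hregular : ∀ x ∈ F.carrier, IsRegularPoint d f x)
    (n : ℕ) (S : Submodule ℂ (F.RatAnticanonical M n))
    (hS : F.IsMovableSystem M n S)
    (Y : ProjVariety (M + k)) (hYF : Y.carrier ⊆ F.carrier) (hY : Y.HasDim k) :
    F.multSystem Y S ≤ (n : ℕ∞) := by
  exact lemma2p1_general (by omega) hF hsmooth hS.le hS.ne_bot hYF hY
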